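/- Let $V$ nodes $1,\dots,V$ be divided into $d$ layers, let $V_j$ be the number of nodes in layer $j$, and let $\theta,\theta_0>0$. The H-DP prior $\mathrm{pExP}(V_1,\dots,V_d;\theta,\theta_0)$, jointly with its latent subgroup allocations, is generated as follows (Chinese restaurant franchise). Let $G_1,\dots,G_d$ and $P_0$ be diffuse probability measures on standard Borel spaces, and let $\tilde Q_1,\dots,\tilde Q_d,\tilde P_0$ be independent with $\tilde Q_j\sim \mathrm{DP}(\theta,G_j)$ and $\tilde P_0\sim \mathrm{DP}(\theta_0,P_0)$, where $\mathrm{DP}$ denotes the Dirichlet process. Given these, draw independently a label $t_u\sim\tilde Q_j$ for each node $u$ of each layer $j$, and labels $s_{j\tau}\sim\tilde P_0$ for all $j,\tau$. In each layer the ties among the $t_u$ partition the nodes into subgroups, numbered $1,2,\dots$ in order of appearance; $w_u$ is the number of the subgroup of $u$. Put $x_u=s_{jw_u}$ for $u$ in layer $j$; the ties among the $x_u$ partition all the nodes into groups (sociability profiles), numbered in order of appearance; $z_u$ is the number of the group of $u$. Fix a node $v$ in layer $j$. Let $\mathbf z^{-v}$ and $\mathbf w^{-v}$ be the group and subgroup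 allocations of the other nodes, with labels renumbered in order of appearance after removing $v$. In the event below $z_v$ and $w_v$ are expressed in these labels (with $w_v$ in those of layer $j$), the first unused label meaning a new group, respectively a new subgroup. All the following quantities are computed without $v$: $H^{-v}$ is the number of groups; $\ell_{j\cdot}^{-v}$ is the number of subgroups in layer $j$; $|\ell^{-v}|$ is the total number of subgroups; $\ell_{jh}^{-v}$ is the number of subgroups of layer $j$ whose nodes are in group $h$; $\ell_{\cdot h}^{-v}=\sum_{j'}\ell_{j'h}^{-v}$; $\tau_{jh1}^{-v}<\dots<\tau_{jh\ell_{jh}^{-v}}^{-v}$ are the labels of the subgroups of layer $j$ whose nodes are in group $h$; and $q_{jht}^{-v}$ is the number of nodes in the subgroup $\tau_{jht}^{-v}$ of layer $j$. Then, for every configuration of $(\mathbf z^{-v},\mathbf w^{-v})$ of positive probability, every $h\in\{1,\dots,H^{-v}+1\}$ and every $\tau\in\{1,\dots,\ell_{j\cdot}^{-v}+1\}$, $$\mathbb P(z_v=h,\,w_v=\tau\mid \mathbf z^{-v},\mathbf w^{-v})=\sum_{t=1}^{\ell_{jh}^{-v}}\mathbf 1\{\tau=\tau_{jht}^{-v}\}\frac{q_{jht}^{-v}}{\theta+V_j-1}+\mathbf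 1\{\tau=\ell_{j\cdot}^{-v}+1\}\frac{\theta}{\theta+V_j-1}\left[\frac{\ell_{\cdot h}^{-v}}{\theta_0+|\ell^{-v}|}+\mathbf 1\{h=H^{-v}+1\}\frac{\theta_0}{\theta_0+|\ell^{-v}|}\right].$$ -/

import Mathlib

open MeasureTheory ProbabilityTheory

/-! ### The Dirichlet process -/

/-- The gamma law with shape `a` and rate `1`; for `a = 0` it is the point mass at `0`. -/
noncomputable def gammaLaw (a : ℝ) : Measure ℝ :=
  open Classical in if 0 < a then gammaMeasure a 1 else Measure.dirac 0

/-- The Dirichlet law with parameter vector `a` (nonnegative entries, not all zero): the law of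
`(y₁ / ∑ y, …, y_k / ∑ y)` for independent `y_i` with gamma law of shape `a_i` and rate `1`. -/
noncomputable def dirichletLaw {k : ℕ} (a : Fin k → ℝ) : Measure (Fin k → ℝ) :=
  (Measure.pi fun i => gammaLaw (a i)).map fun y i => y i / ∑ m, y m

/-- `P` is a Dirichlet process with concentration parameter `θ` and base probability measure `G`:
a random probability measure whose values on every finite measurable partition `A₁, …, A_k` of the
space have the Dirichlet law with parameters `θ G(A₁), …, θ G(A_k)`. -/
structure IsDirichletProcess {Ω E : Type*} [MeasurableSpace Ω] [MeasurableSpace E]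
    (μ : Measure Ω) (P : Ω → Measure E) (θ : ℝ) (G : Measure E) : Prop where
  measurable : Measurable P
  isProbabilityMeasure : ∀ ω, IsProbabilityMeasure (P ω)
  map_partition : ∀ (k : ℕ) (A : Fin k → Set E), (∀ i, MeasurableSet (A i)) →
    Pairwise (fun i i' => Disjoint (A i) (A i')) → (⋃ i, A i) = Set.univ →
    μ.map (fun ω i => (P ω).real (A i)) = dirichletLaw fun i => θ * G.real (A i)

/-! ### Labels in order of appearance -/

/-- The label of item `i` when the distinct values of `f` on the set `S` of items are numbered
`1, 2, …` in order of appearance: one plus the number of distinct values that appear in `S`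
strictly before the first appearance in `S` of the value `f i`. If the value `f i` does not appear
in `S` (possible only for `i ∉ S`), then all values in `S` count, and the label is
the first unused one. -/
noncomputable def orderLabel {ι α : Type*} [LinearOrder ι] (S : Set ι) (f : ι → α) (i : ι) : ℕ :=
  (f '' {k | k ∈ S ∧ ∀ m ∈ S, f m = f i → k < m}).ncard + 1

section Arrays

variable {N d : ℕ} {T X : Type*}

/-- The number `V_j` of nodes in layer `j`. The nodes are `Fin N`, and `lay u` is the layer
of node `u`. -/
def layerSize (lay : Fin N → Fin d) (j : Fin d) : ℕ :=
  (Finset.univ.filter fun u => lay u = j).card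

/-- The subgroup allocation `w_u` of node `u`: the partition of each layer is the one given by the
ties among the labels `t` of its nodes, numbered within the layer in order of appearance. -/
noncomputable def subgroupLabel (lay : Fin N → Fin d) (t : Fin N → T) (u : Fin N) : ℕ :=
  orderLabel {k | lay k = lay u} t u

/-- The latent attribute `x_u` of node `u`, i.e. the sociability profile of its subgroup. -/
noncomputable def nodeProfile (lay : Fin N → Fin d) (t : Fin N → T) (s : Fin d → ℕ → X)
    (u : Fin N) : X :=
  s (lay u) (subgroupLabel lay t u)

/-- The vector `z^{-v}`: group allocations (ties among the `x_u`) of the nodes other than `v`,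
with labels in order of appearance among these nodes. -/
noncomputable def zMinus (lay : Fin N → Fin d) (t : Fin N → T) (s : Fin d → ℕ → X) (v : Fin N) :
    {u : Fin N // u ≠ v} → ℕ :=
  fun u => orderLabel {k | k ≠ v} (nodeProfile lay t s) u

/-- The vector `w^{-v}`: subgroup allocations of the nodes other than `v`,
with labels in order of appearance among the nodes other than `v` of each layer. -/
noncomputable def wMinus (lay : Fin N → Fin d) (t : Fin N → T) (v : Fin N) :
    {u : Fin N // u ≠ v} → ℕ :=
  fun u => orderLabel {k | lay k = lay u ∧ k ≠ v} t u

/-- The group `z_v` of node `v`, in the labels of `z^{-v}`: the label there of the group that `v`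
belongs to, and the first unused label if `v` is alone in its group. -/
noncomputable def zNode (lay : Fin N → Fin d) (t : Fin N → T) (s : Fin d → ℕ → X) (v : Fin N) : ℕ :=
  orderLabel {k | k ≠ v} (nodeProfile lay t s) v

/-- The subgroup `w_v` of node `v`, in the labels of `w^{-v}` within the layer of `v`; the first
unused label of that layer if `v` is alone in its subgroup. -/
noncomputable def wNode (lay : Fin N → Fin d) (t : Fin N → T) (v : Fin N) : ℕ :=
  orderLabel {k | lay k = lay v ∧ k ≠ v} t v

end Arrays

/-! ### The generative scheme of the H-DP -/

/-- The generative scheme of the partially exchangeable partition prior with layer map `lay` that is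
induced by the hierarchical Dirichlet process with concentration parameters `θ`, `θ₀`
(the Chinese restaurant franchise):
`Q₁, …, Q_d, P₀` are independent, `Q_j ~ DP(θ, G_j)` and `P₀ ~ DP(θ₀, G₀)`; given them, all the
variables `t_u` and `s_{jτ}` are independent, with `t_u ~ Q_{lay u}` for every node `u` and
`s_{jτ} ~ P₀` for every layer `j` and every possible subgroup label `τ ∈ {1, …, V_j}`. -/
structure IsHDPScheme {N d : ℕ} {Ω T X : Type*} [MeasurableSpace Ω] [MeasurableSpace T]
    [MeasurableSpace X] (μ : Measure Ω) (lay : Fin N → Fin d) (θ θ₀ : ℝ)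
    (G : Fin d → Measure T) (G₀ : Measure X)
    (Q : Fin d → Ω → Measure T) (P₀ : Ω → Measure X)
    (t : Fin N → Ω → T) (s : Fin d → ℕ → Ω → X) : Prop where
  dirichlet_layer : ∀ j, IsDirichletProcess μ (Q j) θ (G j)
  dirichlet_root : IsDirichletProcess μ P₀ θ₀ G₀
  indep_layers : iIndepFun Q μ
  indep_root : IndepFun (fun ω j => Q j ω) P₀ μ
  measurable_t : ∀ u, Measurable (t u)
  measurable_s : ∀ j τ, Measurable (s j τ)
  conditional_law : ∀ (A : Fin N → Set T) (B : Fin d → ℕ → Set X)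
    (C : Set ((Fin d → Measure T) × Measure X)),
    (∀ u, MeasurableSet (A u)) → (∀ j τ, MeasurableSet (B j τ)) → MeasurableSet C →
    μ {ω | (∀ u, t u ω ∈ A u) ∧ (∀ j, ∀ τ ∈ Finset.Icc 1 (layerSize lay j), s j τ ω ∈ B j τ) ∧
        ((fun j => Q j ω), P₀ ω) ∈ C} =
      ∫⁻ ω in {ω | ((fun j => Q j ω), P₀ ω) ∈ C},
        (∏ u, Q (lay u) ω (A u)) *
          ∏ j, ∏ τ ∈ Finset.Icc 1 (layerSize lay j), P₀ ω (B j τ) ∂μ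

/-! ### Counts of a configuration of group and subgroup labels -/

section Counts

variable {ι : Type*} [Fintype ι] {d : ℕ}

/-- `H`: the number of groups. -/
def numGroups (z : ι → ℕ) : ℕ := (Finset.univ.image z).card

/-- `ℓ_{j·}`: the number of subgroups in layer `j`. -/
def numSubgroups (lay : ι → Fin d) (w : ι → ℕ) (j : Fin d) : ℕ :=
  ((Finset.univ.filter fun u => lay u = j).image w).card

/-- `|ℓ|`: the total number of subgroups. -/
def totalSubgroups (lay : ι → Fin d) (w : ι → ℕ) : ℕ := ∑ j, numSubgroups lay w j

/-- `𝕋_{jh}`: the set of labels of the subgroups of layer `j` with sociability profile `h`;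
its cardinality is `ℓ_{jh}`. -/
def subgroupsWith (lay : ι → Fin d) (z w : ι → ℕ) (j : Fin d) (h : ℕ) : Finset ℕ :=
  (Finset.univ.filter fun u => lay u = j ∧ z u = h).image w

/-- `ℓ_{·h}`: the number of subgroups, in all layers, with sociability profile `h`. -/
def profileSubgroups (lay : ι → Fin d) (z w : ι → ℕ) (h : ℕ) : ℕ :=
  ∑ j, (subgroupsWith lay z w j h).card

/-- `τ_{jht}`: the `t`-th smallest element of `𝕋_{jh}`, for `t = 1, …, ℓ_{jh}`
(with `t` counted from `0` here). -/
def subgroupAt (lay : ι → Fin d) (z w : ι → ℕ) (j : Fin d) (h : ℕ)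
    (t : Fin (subgroupsWith lay z w j h).card) : ℕ :=
  (subgroupsWith lay z w j h).orderEmbOfFin rfl t

/-- `q_{jht}`: the number of nodes of layer `j` in the `t`-th subgroup with profile `h`. -/
def subgroupSize (lay : ι → Fin d) (z w : ι → ℕ) (j : Fin d) (h : ℕ)
    (t : Fin (subgroupsWith lay z w j h).card) : ℕ :=
  (Finset.univ.filter fun u => lay u = j ∧ z u = h ∧ w u = subgroupAt lay z w j h t).card

end Counts

/-! The theorem is the Blackwell-MacQueen urn used twice: in the layer of `v`, to choose its
subgroup, and at the root, to choose the profile of a new subgroup.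

The urn comes from Dirichlet moments. Writing the inverse power of a sum of independent gamma
variables as an integral of exponentials shows that a moment of degree `n > 0` is a product of
rising factorials times a factor that depends only on `n` and the total mass. That factor is never
evaluated: multiplying by the mass of one more cell and summing over all cells recovers the original
moment, so it cancels (`IsDirichletProcess.lintegral_prod_cells_mul`). Refining arbitrary sets to
atoms gives `IsDirichletProcess.lintegral_prod_mul`; independence of the layers and a comparison on
rectangles give `predictive_rule` for arbitrary events. For a diffuse base measure a fresh draw
almost surely differs from all other values, whence `predictive_rule_of_diffuse`.

For the franchise, the labels `t` are independent of the profiles `s`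
(`IsHDPScheme.map_nodes_profiles`), so one may fix `t` and integrate over `s` first. Removing `v`
can renumber the subgroups, so `w` does not determine which coordinates of `s` are read. It does
determine the ties among their indices, and by exchangeability (`map_comp_eq_of_ties`) the
conditional probability of `z` given `t` depends only on these. It is thus a constant `g`, and the
conditioning event has probability equal to that of `w` times `g`. Adding the event about `v`
replaces the first factor through `measure_wMinus_wNode`. In an old subgroup `v` inherits the
profile, so `g` is kept or becomes `0`; in a new one `g` is multiplied by the root urn weight
(`measure_groupsEvent_new`). -/

open scoped ENNReal

/-! ### Moments of the Dirichlet law -/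

/-- The rising factorial `a (a + 1) ⋯ (a + n - 1)`. -/
noncomputable def risingFactorial (a : ℝ) (n : ℕ) : ℝ := ∏ k ∈ Finset.range n, (a + k)

lemma risingFactorial_succ (a : ℝ) (n : ℕ) :
    risingFactorial a (n + 1) = risingFactorial a n * (a + n) :=
  Finset.prod_range_succ _ _

lemma risingFactorial_nonneg {a : ℝ} (ha : 0 ≤ a) (n : ℕ) : 0 ≤ risingFactorial a n :=
  Finset.prod_nonneg fun _ _ => by positivity

/-- Serves the zero parameters of the Dirichlet law, which come from cells of base measure zero. -/
lemma risingFactorial_zero_left {n : ℕ} (hn : n ≠ 0) : risingFactorial 0 n = 0 :=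
  Finset.prod_eq_zero (Finset.mem_range.2 (Nat.pos_of_ne_zero hn)) (by simp)

lemma Gamma_add_natCast {a : ℝ} (ha : 0 < a) (n : ℕ) :
    Real.Gamma (a + n) = risingFactorial a n * Real.Gamma a := by
  induction n with
  | zero => simp [risingFactorial]
  | succ n ih =>
    have : a + n ≠ 0 := by positivity
    rw [Nat.cast_succ, ← add_assoc, Real.Gamma_add_one this, ih, risingFactorial_succ]
    ring

instance isProbabilityMeasure_gammaLaw (a : ℝ) : IsProbabilityMeasure (gammaLaw a) := by
  unfold gammaLaw
  split_ifs with h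
  · exact isProbabilityMeasure_gammaMeasure h one_pos
  · infer_instance

lemma ae_nonneg_gammaLaw (a : ℝ) : ∀ᵐ y ∂gammaLaw a, 0 ≤ y := by
  unfold gammaLaw
  split_ifs with h
  · rw [gammaMeasure, ae_withDensity_iff (by unfold gammaPDF; fun_prop)]
    refine ae_of_all _ fun y hy => ?_
    by_contra hlt
    exact hy (gammaPDF_of_neg (not_le.1 hlt))
  · rw [ae_dirac_iff measurableSet_Ici]

/-- The Laplace transform of the `n`-th power under the gamma law. -/
lemma lintegral_pow_mul_exp_gammaLaw {a : ℝ} (ha : 0 ≤ a) (n : ℕ) {r : ℝ} (hr : 0 ≤ r) :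
    ∫⁻ y, ENNReal.ofReal (y ^ n * Real.exp (-(r * y))) ∂gammaLaw a =
      ENNReal.ofReal (risingFactorial a n * (1 + r) ^ (-(a + n))) := by
  unfold gammaLaw
  split_ifs with h
  · have hG := Real.Gamma_pos_of_pos h
    have h1r : 0 < 1 + r := by positivity
    have han : 0 < a + n := by positivity
    have hc : 0 ≤ risingFactorial a n * (1 + r) ^ (-(a + n)) :=
      mul_nonneg (risingFactorial_nonneg ha n) (by positivity)
    rw [gammaMeasure, lintegral_withDensity_eq_lintegral_mul _ (by unfold gammaPDF; fun_prop)
      (by fun_prop)]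
    -- Tilting the gamma density of shape `a` and rate `1` by the power and the exponential gives,
    -- up to the constant, the density of shape `a + n` and rate `1 + r`. The null point `0` is set
    -- aside because real exponents are added only for positive `y`.
    have key : ∀ y : ℝ, y ≠ 0 → (gammaPDF a 1 * fun y : ℝ =>
        ENNReal.ofReal (y ^ n * Real.exp (-(r * y)))) y =
        ENNReal.ofReal (risingFactorial a n * (1 + r) ^ (-(a + n))) *
          gammaPDF (a + n) (1 + r) y := by
      intro y hy0
      rcases lt_or_gt_of_ne hy0 with hy | hy
      · simp [gammaPDF_of_neg hy]
      · rw [Pi.mul_apply, gammaPDF_of_nonneg hy.le, gammaPDF_of_nonneg hy.le,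
          ← ENNReal.ofReal_mul (by positivity), ← ENNReal.ofReal_mul hc, Gamma_add_natCast h,
          Real.rpow_neg h1r.le]
        congr 1
        have hR : risingFactorial a n ≠ 0 :=
          (Finset.prod_pos fun _ _ => by positivity : 0 < risingFactorial a n).ne'
        have hp : (1 + r) ^ (a + n) ≠ 0 := by positivity
        have e1 : y ^ (a + n - 1) = y ^ (a - 1) * y ^ n := by
          rw [← Real.rpow_natCast y n, ← Real.rpow_add hy]; ring_nf
        have e2 : Real.exp (-((1 + r) * y)) = Real.exp (-(1 * y)) * Real.exp (-(r * y)) := by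
          rw [← Real.exp_add]; ring_nf
        rw [e1, e2, Real.one_rpow]
        field_simp
    have : ∀ᵐ y : ℝ, y ≠ 0 := by simp [ae_iff]
    rw [lintegral_congr_ae (this.mono key), lintegral_const_mul _ (by unfold gammaPDF; fun_prop),
      lintegral_gammaPDF_eq_one han h1r, mul_one]
  · obtain rfl : a = 0 := le_antisymm (not_lt.1 h) ha
    rw [lintegral_dirac' _ (by fun_prop)]
    rcases eq_or_ne n 0 with rfl | hn
    · simp [risingFactorial]
    · simp [hn, risingFactorial_zero_left hn]

/-- The integral over the scale that, by Tonelli, replaces the normalizing power of the sum in the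
moments of degree `n` of a Dirichlet law with total mass `c`. -/
noncomputable def dirichletNorm (c : ℝ) (n : ℕ) : ℝ≥0∞ :=
  ∫⁻ r in Set.Ici (0 : ℝ),
    ENNReal.ofReal (r ^ ((n : ℝ) - 1) / Real.Gamma n * (1 + r) ^ (-(c + n)))

/-- The gamma density of shape `n` and rate `S` has integral one. The gain is that exponentials of a
sum factor over independent summands, while its inverse power does not. -/
lemma ofReal_inv_pow_eq_lintegral {S : ℝ} (hS : 0 < S) {n : ℕ} (hn : n ≠ 0) :
    ENNReal.ofReal (S ^ n)⁻¹ = ∫⁻ r in Set.Ici (0 : ℝ),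
      ENNReal.ofReal (r ^ ((n : ℝ) - 1) / Real.Gamma n * Real.exp (-(r * S))) := by
  have hn' : 0 < (n : ℝ) := by positivity
  have hG := Real.Gamma_pos_of_pos hn'
  have h1 := lintegral_gammaPDF_eq_one hn' hS
  have h2 : ∫⁻ r, gammaPDF n S r = ∫⁻ r in Set.Ici (0 : ℝ), gammaPDF n S r := by
    rw [← lintegral_indicator measurableSet_Ici]
    refine lintegral_congr fun r => ?_
    by_cases hr : 0 ≤ r
    · rw [Set.indicator_of_mem (Set.mem_Ici.2 hr)]
    · rw [Set.indicator_of_notMem (by simpa using hr), gammaPDF_of_neg (not_le.1 hr)]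
  rw [← mul_one (ENNReal.ofReal _), ← h1, h2,
    ← lintegral_const_mul _ (by unfold gammaPDF; fun_prop)]
  refine setLIntegral_congr_fun measurableSet_Ici fun r (hr : 0 ≤ r) => ?_
  rw [gammaPDF_of_nonneg hr, ← ENNReal.ofReal_mul (by positivity), Real.rpow_natCast,
    mul_comm r S]
  congr 1
  field_simp

lemma lintegral_pi_prod {k : ℕ} (ν : Fin k → Measure ℝ) [∀ i, IsProbabilityMeasure (ν i)]
    (g : Fin k → ℝ → ℝ≥0∞) (hg : ∀ i, Measurable (g i)) :
    ∫⁻ y, ∏ i, g i (y i) ∂Measure.pi ν = ∏ i, ∫⁻ x, g i x ∂ν i := by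
  have hind := iIndepFun_pi (μ := ν) (X := g) fun i => (hg i).aemeasurable
  rw [lintegral_prod_eq_prod_lintegral_of_indepFun Finset.univ _ hind
    fun i => (hg i).comp (measurable_pi_apply i)]
  refine Finset.prod_congr rfl fun i _ => ?_
  rw [← (measurePreserving_eval ν i).map_eq, lintegral_map (hg i) (measurable_pi_apply i)]

/-- The moments of positive degree of the Dirichlet law. -/
lemma lintegral_prod_pow_dirichletLaw {k : ℕ} {a : Fin k → ℝ} (ha : ∀ i, 0 ≤ a i)
    (n : Fin k → ℕ) (hn : ∑ i, n i ≠ 0) :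
    ∫⁻ x, ∏ i, ENNReal.ofReal (x i) ^ n i ∂dirichletLaw a =
      ENNReal.ofReal (∏ i, risingFactorial (a i) (n i)) *
        dirichletNorm (∑ i, a i) (∑ i, n i) := by
  set m := ∑ i, n i with hm
  have hm' : 0 < (m : ℝ) := by positivity
  have hG := Real.Gamma_pos_of_pos hm'
  have hpos : ∀ᵐ y ∂Measure.pi fun i => gammaLaw (a i), ∀ i, 0 ≤ y i :=
    ae_all_iff.2 fun i => (measurePreserving_eval (fun i => gammaLaw (a i)) i).quasiMeasurePreserving.ae
      (ae_nonneg_gammaLaw (a i))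
  have hpt : ∀ y : Fin k → ℝ, (∀ i, 0 ≤ y i) →
      ∏ i, ENNReal.ofReal (y i / ∑ l, y l) ^ n i =
        ∫⁻ r in Set.Ici (0 : ℝ), ENNReal.ofReal (r ^ ((m : ℝ) - 1) / Real.Gamma m) *
          ∏ i, ENNReal.ofReal (y i ^ n i * Real.exp (-(r * y i))) := by
    intro y hy
    have e : ∀ r ∈ Set.Ici (0 : ℝ), ENNReal.ofReal (r ^ ((m : ℝ) - 1) / Real.Gamma m) *
          ∏ i, ENNReal.ofReal (y i ^ n i * Real.exp (-(r * y i))) =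
        ENNReal.ofReal (∏ i, y i ^ n i) *
          ENNReal.ofReal (r ^ ((m : ℝ) - 1) / Real.Gamma m * Real.exp (-(r * ∑ i, y i))) := by
      intro r hr
      have hr : 0 ≤ r := hr
      rw [← ENNReal.ofReal_prod_of_nonneg fun i _ => mul_nonneg (pow_nonneg (hy i) _) (by positivity),
        ← ENNReal.ofReal_mul (by positivity),
        ← ENNReal.ofReal_mul (Finset.prod_nonneg fun i _ => pow_nonneg (hy i) _),
        Finset.prod_mul_distrib, ← Real.exp_sum, Finset.sum_neg_distrib, ← Finset.mul_sum]
      congr 1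
      ring
    rw [setLIntegral_congr_fun measurableSet_Ici e, lintegral_const_mul _ (by fun_prop)]
    -- If the sum vanishes, the normalized coordinates are `0 / 0 = 0`; both sides are zero because
    -- some exponent is positive.
    rcases (Finset.sum_nonneg fun i _ => hy i : 0 ≤ ∑ i, y i).eq_or_lt with hS | hS
    · have hy0 : ∀ i, y i = 0 := fun i =>
        (Finset.sum_eq_zero_iff_of_nonneg fun i _ => hy i).1 hS.symm i (Finset.mem_univ i)
      obtain ⟨i, hi, hni⟩ := Finset.exists_ne_zero_of_sum_ne_zero hn
      have z1 : ∏ i, y i ^ n i = 0 := Finset.prod_eq_zero hi (by simp [hy0, hni])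
      rw [z1, ENNReal.ofReal_zero, zero_mul]
      exact Finset.prod_eq_zero hi (by simp [hy0, hni])
    · rw [← ofReal_inv_pow_eq_lintegral hS hn,
        ← ENNReal.ofReal_mul (Finset.prod_nonneg fun i _ => pow_nonneg (hy i) _), hm,
        ← Finset.prod_pow_eq_pow_sum, ← Finset.prod_inv_distrib, ← Finset.prod_mul_distrib,
        ENNReal.ofReal_prod_of_nonneg fun i _ =>
          mul_nonneg (pow_nonneg (hy i) _) (inv_nonneg.2 (pow_nonneg hS.le _))]
      refine Finset.prod_congr rfl fun i _ => ?_
      rw [← ENNReal.ofReal_pow (div_nonneg (hy i) hS.le), div_pow, div_eq_mul_inv]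
  rw [dirichletLaw, lintegral_map (by fun_prop) (by fun_prop),
    lintegral_congr_ae (hpos.mono hpt), lintegral_lintegral_swap (by fun_prop), dirichletNorm,
    ← lintegral_const_mul _ (by fun_prop)]
  refine setLIntegral_congr_fun measurableSet_Ici fun r (hr : 0 ≤ r) => ?_
  rw [lintegral_const_mul _ (by fun_prop),
    lintegral_pi_prod _ (fun i x => ENNReal.ofReal (x ^ n i * Real.exp (-(r * x))))
      (fun i => by fun_prop),
    Finset.prod_congr rfl fun i _ => lintegral_pow_mul_exp_gammaLaw (ha i) (n i) hr,
    ← ENNReal.ofReal_prod_of_nonneg fun i _ =>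
      mul_nonneg (risingFactorial_nonneg (ha i) _) (by positivity),
    ← ENNReal.ofReal_mul (by positivity),
    ← ENNReal.ofReal_mul (Finset.prod_nonneg fun i _ => risingFactorial_nonneg (ha i) _),
    Finset.prod_mul_distrib, ← Real.rpow_sum_of_pos (by positivity)]
  congr 1
  rw [hm, Finset.sum_neg_distrib, Finset.sum_add_distrib]
  push_cast
  ring

/-! ### Sampling from a Dirichlet process -/

lemma prod_comp_eq_prod_pow {ι β M : Type*} [Fintype ι] [Fintype β] [DecidableEq β] [CommMonoid M]
    (m : ι → β) (g : β → M) : ∏ i, g (m i) = ∏ c, g c ^ ∑ i, if m i = c then 1 else 0 := by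
  simp_rw [← Finset.prod_pow_eq_pow_sum]
  rw [Finset.prod_comm]
  refine Finset.prod_congr rfl fun i _ => ?_
  simp [pow_ite]

section

variable {Ω E : Type*} [MeasurableSpace Ω] [MeasurableSpace E] {μ : Measure Ω}
  {P : Ω → Measure E} {θ : ℝ} {G : Measure E}

namespace IsDirichletProcess

lemma measurable_apply (hP : IsDirichletProcess μ P θ G) {A : Set E} (hA : MeasurableSet A) :
    Measurable fun ω => P ω A :=
  (Measure.measurable_coe hA).comp hP.measurable

/-- The joint moments of a Dirichlet process on the cells of a finite partition. -/
lemma lintegral_prod_cells (hP : IsDirichletProcess μ P θ G) (hθ : 0 < θ) [IsProbabilityMeasure G]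
    {ι β : Type*} [Fintype ι] [Nonempty ι] [Fintype β] [DecidableEq β] [MeasurableSpace β]
    [MeasurableSingletonClass β] {f : E → β} (hf : Measurable f) (m : ι → β) :
    ∫⁻ ω, ∏ i, P ω (f ⁻¹' {m i}) ∂μ =
      ENNReal.ofReal (∏ c, risingFactorial (θ * G.real (f ⁻¹' {c})) (∑ i, if m i = c then 1 else 0))
        * dirichletNorm θ (Fintype.card ι) := by
  classical
  have hms : ∀ c, MeasurableSet (f ⁻¹' {c}) := fun c => hf (measurableSet_singleton c)
  have hprob := hP.isProbabilityMeasure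
  let e := (Fintype.equivFin β).symm
  set n : β → ℕ := fun c => ∑ i, if m i = c then 1 else 0 with hn
  have hnsum : ∑ c, n c = Fintype.card ι := by
    rw [hn, Finset.sum_comm]; simp
  have hGsum : ∑ c, θ * G.real (f ⁻¹' {c}) = θ := by
    rw [← Finset.mul_sum, sum_measureReal_preimage_singleton _ fun c _ => hms c]
    simp
  have hmap := hP.map_partition _ (fun i => f ⁻¹' {e i}) (fun i => hms _)
    (fun i i' hii => Disjoint.preimage _ (by simpa using hii))
    (Set.eq_univ_of_forall fun x => Set.mem_iUnion.2 ⟨e.symm (f x), by simp⟩)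
  have key := lintegral_prod_pow_dirichletLaw (a := fun i => θ * G.real (f ⁻¹' {e i}))
    (fun i => mul_nonneg hθ.le measureReal_nonneg) (fun i => n (e i))
    (by rw [e.sum_comp n, hnsum]; exact Fintype.card_ne_zero)
  have hmeas : Measurable fun ω i => (P ω).real (f ⁻¹' {e i}) :=
    measurable_pi_lambda _ fun i => (hP.measurable_apply (hms _)).ennreal_toReal
  rw [e.sum_comp n, hnsum, e.sum_comp fun c => θ * G.real (f ⁻¹' {c}), hGsum,
    e.prod_comp fun c => risingFactorial (θ * G.real (f ⁻¹' {c})) (n c), ← hmap,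
    lintegral_map (by fun_prop) hmeas] at key
  rw [← key]
  refine lintegral_congr fun ω => ?_
  have hreal : ∀ A, ENNReal.ofReal ((P ω).real A) = P ω A := fun A => ofReal_measureReal
  simp_rw [hreal]
  rw [e.prod_comp fun c => P ω (f ⁻¹' {c}) ^ n c]
  exact prod_comp_eq_prod_pow m fun c => P ω (f ⁻¹' {c})

/-- The predictive rule of a Dirichlet process on the cells of a finite partition. -/
lemma lintegral_prod_cells_mul (hP : IsDirichletProcess μ P θ G) (hθ : 0 < θ)
    [IsProbabilityMeasure G]
    {ι β : Type*} [Fintype ι] [Fintype β] [DecidableEq β] [MeasurableSpace β]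
    [MeasurableSingletonClass β] {f : E → β} (hf : Measurable f) (m : ι → β) (b : β) :
    ENNReal.ofReal (θ + Fintype.card ι) * ∫⁻ ω, (∏ i, P ω (f ⁻¹' {m i})) * P ω (f ⁻¹' {b}) ∂μ =
      (ENNReal.ofReal θ * G (f ⁻¹' {b}) + ∑ i, if m i = b then 1 else 0) *
        ∫⁻ ω, ∏ i, P ω (f ⁻¹' {m i}) ∂μ := by
  classical
  have hms : ∀ c, MeasurableSet (f ⁻¹' {c}) := fun c => hf (measurableSet_singleton c)
  have hprob := hP.isProbabilityMeasure
  set n : β → ℕ := fun c => ∑ i, if m i = c then 1 else 0 with hn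
  set a : β → ℝ := fun c => θ * G.real (f ⁻¹' {c}) with ha
  have ha0 : ∀ c, 0 ≤ a c := fun c => mul_nonneg hθ.le measureReal_nonneg
  have hnsum : ∑ c, n c = Fintype.card ι := by
    rw [hn, Finset.sum_comm]; simp
  have hGsum : ∑ c, a c = θ := by
    rw [ha, ← Finset.mul_sum, sum_measureReal_preimage_singleton _ fun c _ => hms c]
    simp
  set R : ℝ≥0∞ := ENNReal.ofReal (∏ c, risingFactorial (a c) (n c)) with hR
  set J := dirichletNorm θ (Fintype.card ι + 1)
  -- The extra cell is an extra index in `Option ι`. It keeps the degree positive even for empty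
  -- `ι`, and contributes the factor `a b + n b` to the rising factorials.
  have hstep : ∀ b, ∫⁻ ω, (∏ i, P ω (f ⁻¹' {m i})) * P ω (f ⁻¹' {b}) ∂μ =
      ENNReal.ofReal (a b + n b) * (R * J) := by
    intro b
    have := hP.lintegral_prod_cells hθ hf (fun o : Option ι => o.elim b m)
    simp only [Fintype.prod_option, Option.elim, Fintype.sum_option, Fintype.card_option] at this
    simp_rw [mul_comm (∏ i, _) (P _ _)]
    rw [this, ← mul_assoc, hR, ← ENNReal.ofReal_mul (by have := ha0 b; positivity)]
    congr 2
    have : ∀ c, risingFactorial (a c) ((if b = c then 1 else 0) + n c) =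
        (if b = c then a c + n c else 1) * risingFactorial (a c) (n c) := by
      intro c
      split_ifs
      · rw [add_comm, risingFactorial_succ, mul_comm]
      · simp
    refine (Finset.prod_congr rfl fun c _ => this c).trans ?_
    rw [Finset.prod_mul_distrib]
    simp
  -- The cells exhaust the space, so the moment without the extra cell is the sum of `hstep` over
  -- `b`. It carries the same factor `R * J`, which therefore never has to be computed.
  have htot : ∫⁻ ω, ∏ i, P ω (f ⁻¹' {m i}) ∂μ = ENNReal.ofReal (θ + Fintype.card ι) * (R * J) := by
    have h1 : ∀ ω, ∏ i, P ω (f ⁻¹' {m i}) = ∑ b, (∏ i, P ω (f ⁻¹' {m i})) * P ω (f ⁻¹' {b}) := by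
      intro ω
      rw [← Finset.mul_sum, sum_measure_preimage_singleton _ fun c _ => hms c]
      simp
    have h2 : ∀ b, Measurable fun ω => (∏ i, P ω (f ⁻¹' {m i})) * P ω (f ⁻¹' {b}) := fun b =>
      (Finset.measurable_fun_prod _ fun i _ => hP.measurable_apply (hms _)).mul
        (hP.measurable_apply (hms _))
    rw [lintegral_congr h1, lintegral_finsetSum _ fun b _ => h2 b]
    simp_rw [hstep]
    rw [← Finset.sum_mul, ← ENNReal.ofReal_sum_of_nonneg fun c _ => by
      have := ha0 c; positivity, Finset.sum_add_distrib, hGsum, ← hnsum]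
    push_cast
    rfl
  rw [hstep, htot, ENNReal.ofReal_add (ha0 b) (by positivity), ha,
    ENNReal.ofReal_mul hθ.le, ofReal_measureReal, ENNReal.ofReal_natCast, hn]
  push_cast
  ring

/-- The predictive rule of a Dirichlet process: the Blackwell-MacQueen urn scheme. -/
lemma lintegral_prod_mul (hP : IsDirichletProcess μ P θ G) (hθ : 0 < θ) [IsProbabilityMeasure G]
    {ι : Type*} [Fintype ι] [DecidableEq ι] {A : ι → Set E} (hA : ∀ i, MeasurableSet (A i))
    {B : Set E} (hB : MeasurableSet B) :
    ENNReal.ofReal (θ + Fintype.card ι) * ∫⁻ ω, (∏ i, P ω (A i)) * P ω B ∂μ =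
      ENNReal.ofReal θ * G B * ∫⁻ ω, ∏ i, P ω (A i) ∂μ +
        ∑ i, ∫⁻ ω, ∏ k, P ω (if k = i then A k ∩ B else A k) ∂μ := by
  classical
  let β := (ι → Prop) × Prop
  -- The fibres of `f` are the atoms of the algebra generated by the `A i` and `B`, and each set
  -- involved is a union of atoms.
  let f : E → β := fun x => (fun i => x ∈ A i, x ∈ B)
  have hf : Measurable f :=
    (measurable_pi_lambda _ fun i => measurable_mem.2 (hA i)).prodMk (measurable_mem.2 hB)
  have hms : ∀ c, MeasurableSet (f ⁻¹' {c}) := fun c => hf (measurableSet_singleton c)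
  let C : Ω → β → ℝ≥0∞ := fun ω c => P ω (f ⁻¹' {c})
  have hC : ∀ c, Measurable fun ω => C ω c := fun c => hP.measurable_apply (hms c)
  have hcell : ∀ (ν : Measure E) (p : β → Prop), ν {x | p (f x)} =
      ∑ c, (if p c then 1 else 0) * ν (f ⁻¹' {c}) := by
    intro ν p
    rw [show {x | p (f x)} = f ⁻¹' ((Finset.univ.filter p : Finset β) : Set β) by ext; simp,
      ← sum_measure_preimage_singleton _ fun c _ => hms c, Finset.sum_filter]
    simp
  have hAi : ∀ (ν : Measure E) i, ν (A i) = ∑ c : β, (if c.1 i then 1 else 0) * ν (f ⁻¹' {c}) :=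
    fun ν i => hcell ν fun c => c.1 i
  have hBi : ∀ ν : Measure E, ν B = ∑ c : β, (if c.2 then 1 else 0) * ν (f ⁻¹' {c}) :=
    fun ν => hcell ν fun c => c.2
  have hABi : ∀ (ν : Measure E) i k, ν (if k = i then A k ∩ B else A k) =
      ∑ c : β, (if c.1 k then 1 else 0) * (if k = i then if c.2 then 1 else 0 else 1) *
        ν (f ⁻¹' {c}) := by
    intro ν i k
    split_ifs with hk
    · refine (hcell ν fun c => c.1 k ∧ c.2).trans (Finset.sum_congr rfl fun c _ => ?_)
      by_cases h1 : c.1 k <;> by_cases h2 : c.2 <;> simp [h1, h2]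
    · simpa using hAi ν k
  -- Indicator that the atom assigned to each `i` lies in `A i`; expanding a product of measures
  -- gives a sum over such assignments.
  let χ : (ι → β) → ℝ≥0∞ := fun m => ∏ i, if (m i).1 i then 1 else 0
  have hprodA : ∀ ω, ∏ i, P ω (A i) = ∑ m : ι → β, χ m * ∏ i, C ω (m i) := by
    intro ω
    simp_rw [hAi]
    rw [Finset.prod_univ_sum, Fintype.piFinset_univ]
    simp_rw [Finset.prod_mul_distrib]
    rfl
  have hprodAB : ∀ i ω, ∏ k, P ω (if k = i then A k ∩ B else A k) =
      ∑ m : ι → β, χ m * (if (m i).2 then 1 else 0) * ∏ i, C ω (m i) := by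
    intro i ω
    simp_rw [hABi]
    rw [Finset.prod_univ_sum, Fintype.piFinset_univ]
    simp_rw [Finset.prod_mul_distrib]
    refine Finset.sum_congr rfl fun m _ => ?_
    rw [Finset.prod_ite_eq' Finset.univ i fun x => if (m x).2 then (1 : ℝ≥0∞) else 0]
    simp [χ, C]
  have hmC : ∀ m : ι → β, Measurable fun ω => ∏ i, C ω (m i) := fun m =>
    Finset.measurable_fun_prod _ fun i _ => hC _
  have hIA : ∫⁻ ω, ∏ i, P ω (A i) ∂μ = ∑ m : ι → β, χ m * ∫⁻ ω, ∏ i, C ω (m i) ∂μ := by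
    rw [lintegral_congr hprodA, lintegral_finsetSum _ fun m _ => (hmC m).const_mul _]
    simp_rw [lintegral_const_mul _ (hmC _)]
  have hIAB : ∀ i, ∫⁻ ω, ∏ k, P ω (if k = i then A k ∩ B else A k) ∂μ =
      ∑ m : ι → β, χ m * (if (m i).2 then 1 else 0) * ∫⁻ ω, ∏ i, C ω (m i) ∂μ := by
    intro i
    rw [lintegral_congr (hprodAB i), lintegral_finsetSum _ fun m _ => (hmC m).const_mul _]
    simp_rw [lintegral_const_mul _ (hmC _)]
  have hI : ∫⁻ ω, (∏ i, P ω (A i)) * P ω B ∂μ = ∑ m : ι → β, χ m *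
      ∑ b : β, (if b.2 then 1 else 0) * ∫⁻ ω, (∏ i, C ω (m i)) * C ω b ∂μ := by
    have : ∀ ω, (∏ i, P ω (A i)) * P ω B = ∑ m : ι → β, χ m *
        ∑ b : β, (if b.2 then 1 else 0) * ((∏ i, C ω (m i)) * C ω b) := by
      intro ω
      rw [hprodA, hBi, Finset.sum_mul]
      refine Finset.sum_congr rfl fun m _ => ?_
      rw [mul_assoc, Finset.mul_sum]
      congr 1
      refine Finset.sum_congr rfl fun b _ => ?_
      simp only [C]
      ring
    have hmb : ∀ (m : ι → β) b, Measurable fun ω => (∏ i, C ω (m i)) * C ω b :=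
      fun m b => (hmC m).mul (hC b)
    rw [lintegral_congr this, lintegral_finsetSum _ fun m _ =>
      (Finset.measurable_fun_sum _ fun b _ => (hmb m b).const_mul _).const_mul _]
    refine Finset.sum_congr rfl fun m _ => ?_
    rw [lintegral_const_mul _ (Finset.measurable_fun_sum _ fun b _ => (hmb m b).const_mul _),
      lintegral_finsetSum _ fun b _ => (hmb m b).const_mul _]
    simp_rw [lintegral_const_mul _ (hmb m _)]
  rw [hI, hIA]
  simp_rw [hIAB]
  rw [Finset.mul_sum, Finset.mul_sum, Finset.sum_comm, ← Finset.sum_add_distrib]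
  refine Finset.sum_congr rfl fun m _ => ?_
  have hcells := fun b => hP.lintegral_prod_cells_mul hθ hf m b
  -- For a fixed assignment `m`, the one-cell rule is summed over the atoms contained in `B`.
  have hmass : ∑ b : β, (if b.2 then 1 else 0) *
      (ENNReal.ofReal θ * G (f ⁻¹' {b}) + ∑ i, if m i = b then 1 else 0) =
      ENNReal.ofReal θ * G B + ∑ i, if (m i).2 then 1 else 0 := by
    simp_rw [mul_add, Finset.sum_add_distrib, hBi G, Finset.mul_sum, mul_left_comm]
    rw [Finset.sum_comm]
    congr 1
    refine Finset.sum_congr rfl fun i _ => ?_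
    rw [Finset.sum_eq_single (m i) (fun b _ hb => by simp [hb.symm]) (by simp)]
    simp
  rw [mul_left_comm, Finset.mul_sum]
  simp_rw [mul_left_comm (ENNReal.ofReal (θ + _)) (if _ then _ else _), C, hcells, ← mul_assoc]
  rw [← Finset.sum_mul, hmass, add_mul, mul_add, mul_left_comm, Finset.sum_mul, Finset.mul_sum]
  simp_rw [mul_assoc]

end IsDirichletProcess

end

/-! ### Sampling from independent Dirichlet processes -/

lemma Measure.ext_of_univ_pi {ι E : Type*} [Fintype ι] [MeasurableSpace E]
    {ν ν' : Measure (ι → E)} [IsFiniteMeasure ν]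
    (h : ∀ A : ι → Set E, (∀ i, MeasurableSet (A i)) → ν (Set.univ.pi A) = ν' (Set.univ.pi A)) :
    ν = ν' := by
  refine ext_of_generate_finite _ generateFrom_pi.symm isPiSystem_pi ?_ ?_
  · rintro _ ⟨A, hA, rfl⟩
    exact h A fun i => hA i (Set.mem_univ i)
  · simpa using h (fun _ => Set.univ) fun _ => MeasurableSet.univ

section

variable {Ω E ι J : Type*} [MeasurableSpace Ω] [MeasurableSpace E] {μ : Measure Ω}
  [Fintype ι] [Fintype J] [DecidableEq J]
  {Q : J → Ω → Measure E} {θ : ℝ} {G : J → Measure E}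

/-- Grouping the factors by layer leaves one function of each `Q j`, and these functions are
independent. -/
lemma lintegral_prod_layers (hQ : ∀ j, IsDirichletProcess μ (Q j) θ (G j)) (hind : iIndepFun Q μ)
    (lay : ι → J) {A : ι → Set E} (hA : ∀ i, MeasurableSet (A i)) :
    ∫⁻ ω, ∏ u, Q (lay u) ω (A u) ∂μ =
      ∏ j, ∫⁻ ω, ∏ u ∈ Finset.univ.filter (fun u => lay u = j), Q j ω (A u) ∂μ := by
  have hg : ∀ j, Measurable fun ν : Measure E =>
      ∏ u ∈ Finset.univ.filter (fun u => lay u = j), ν (A u) := fun j =>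
    Finset.measurable_fun_prod _ fun u _ => Measure.measurable_coe (hA u)
  rw [← lintegral_prod_eq_prod_lintegral_of_indepFun Finset.univ
    (fun j ω => ∏ u ∈ Finset.univ.filter (fun u => lay u = j), Q j ω (A u))
    (hind.comp _ hg) fun j => (hg j).comp (hQ j).measurable]
  refine lintegral_congr fun ω => ?_
  rw [← Finset.prod_fiberwise Finset.univ lay]
  refine Finset.prod_congr rfl fun j _ => Finset.prod_congr rfl fun u hu => ?_
  rw [(Finset.mem_filter.1 hu).2]

/-- The predictive rule for item `v`, on rectangles. -/
lemma lintegral_prod_layers_predictive [DecidableEq ι] (hQ : ∀ j, IsDirichletProcess μ (Q j) θ (G j))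
    (hind : iIndepFun Q μ) (hθ : 0 < θ) [∀ j, IsProbabilityMeasure (G j)]
    (lay : ι → J) (v : ι) {A : ι → Set E} (hA : ∀ i, MeasurableSet (A i)) :
    ENNReal.ofReal (θ + (Finset.univ.filter fun u => u ≠ v ∧ lay u = lay v).card) *
        ∫⁻ ω, ∏ u, Q (lay u) ω (A u) ∂μ =
      ENNReal.ofReal θ * G (lay v) (A v) *
          ∫⁻ ω, ∏ u, Q (lay u) ω (Function.update A v Set.univ u) ∂μ +
        ∑ u ∈ Finset.univ.filter (fun u => u ≠ v ∧ lay u = lay v),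
          ∫⁻ ω, ∏ k, Q (lay k) ω
            (Function.update (Function.update A v Set.univ) u (A u ∩ A v) k) ∂μ := by
  set S := Finset.univ.filter fun u => u ≠ v ∧ lay u = lay v with hS
  have hprob := fun j => (hQ j).isProbabilityMeasure
  have hlayer : Finset.univ.filter (fun u => lay u = lay v) = insert v S := by
    ext u
    by_cases h : u = v <;> simp [hS, h]
  have hvS : v ∉ S := by simp [hS]
  let rest := ∏ j ∈ Finset.univ.erase (lay v),
    ∫⁻ ω, ∏ u ∈ Finset.univ.filter (fun u => lay u = j), Q j ω (A u) ∂μ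
  -- Every term of the identity changes sets only in the layer of `v`, so the other layers
  -- contribute the common factor `rest` and the urn of a single layer suffices.
  have hsplit : ∀ B : ι → Set E, (∀ i, MeasurableSet (B i)) →
      (∀ u, lay u ≠ lay v → B u = A u) → ∫⁻ ω, ∏ u, Q (lay u) ω (B u) ∂μ =
        (∫⁻ ω, (∏ u : S, Q (lay v) ω (B u)) * Q (lay v) ω (B v) ∂μ) * rest := by
    intro B hB hBA
    rw [lintegral_prod_layers hQ hind lay hB, ← Finset.mul_prod_erase _ _ (Finset.mem_univ (lay v))]
    congr 1
    · refine lintegral_congr fun ω => ?_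
      rw [hlayer, Finset.prod_insert hvS, mul_comm,
        Finset.prod_coe_sort S fun u => Q (lay v) ω (B u)]
    · refine Finset.prod_congr rfl fun j hj => lintegral_congr fun ω =>
        Finset.prod_congr rfl fun u hu => ?_
      rw [hBA u]
      rw [(Finset.mem_filter.1 hu).2]
      exact (Finset.mem_erase.1 hj).1
  have hA' : ∀ i, MeasurableSet (Function.update A v Set.univ i) := by
    intro i
    rcases eq_or_ne i v with rfl | hi
    · simp
    · simpa [hi] using hA i
  have hne : ∀ u : S, (u : ι) ≠ v := fun u => (Finset.mem_filter.1 u.2).2.1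
  have key := (hQ (lay v)).lintegral_prod_mul hθ (fun u : S => hA u) (hA v)
  rw [Fintype.card_coe] at key
  rw [hsplit A hA fun _ _ => rfl, hsplit _ hA' fun u hu => by
      rw [Function.update_of_ne (by rintro rfl; exact hu rfl)],
    ← mul_assoc, key, add_mul, Finset.sum_mul, ← mul_assoc]
  congr 1
  · congr 2
    refine lintegral_congr fun ω => ?_
    simp [hne]
  · rw [← Finset.sum_coe_sort S]
    refine Finset.sum_congr rfl fun u _ => ?_
    have huv := hne u
    have hlu : lay u = lay v := (Finset.mem_filter.1 u.2).2.2
    rw [hsplit]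
    · congr 1
      refine lintegral_congr fun ω => ?_
      rw [Function.update_of_ne huv.symm, Function.update_self, measure_univ, mul_one]
      refine Finset.prod_congr rfl fun k _ => ?_
      split_ifs with hk
      · rw [hk, Function.update_self]
      · rw [Function.update_of_ne (fun h => hk (Subtype.ext h)), Function.update_of_ne (hne k)]
    · intro i
      rcases eq_or_ne i u with rfl | hi
      · simpa using (hA _).inter (hA v)
      · rw [Function.update_of_ne hi]; exact hA' i
    · intro i hi
      rw [Function.update_of_ne (by rintro rfl; exact hi hlu),
        Function.update_of_ne (by rintro rfl; exact hi rfl)]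

/-- The predictive rule for item `v` in a sample from independent Dirichlet processes: given the
other items, item `v` is either drawn afresh or copied from an item of the same layer. -/
theorem predictive_rule [DecidableEq ι] (hQ : ∀ j, IsDirichletProcess μ (Q j) θ (G j))
    (hind : iIndepFun Q μ) (hθ : 0 < θ) [∀ j, IsProbabilityMeasure (G j)]
    (lay : ι → J) (v : ι) (ν : Measure (ι → E)) [IsFiniteMeasure ν]
    (hν : ∀ A : ι → Set E, (∀ i, MeasurableSet (A i)) →
      ν (Set.univ.pi A) = ∫⁻ ω, ∏ u, Q (lay u) ω (A u) ∂μ)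
    {D : Set (ι → E)} (hD : MeasurableSet D) :
    ENNReal.ofReal (θ + (Finset.univ.filter fun u => u ≠ v ∧ lay u = lay v).card) * ν D =
      ENNReal.ofReal θ * ∫⁻ y, ν {x | Function.update x v y ∈ D} ∂G (lay v) +
        ∑ u ∈ Finset.univ.filter (fun u => u ≠ v ∧ lay u = lay v),
          ν {x | Function.update x v (x u) ∈ D} := by
  set S := Finset.univ.filter fun u => u ≠ v ∧ lay u = lay v with hS
  have hm1 : Measurable fun p : E × (ι → E) => Function.update p.2 v p.1 :=
    measurable_update'.comp measurable_swap
  have hm2 : ∀ u, Measurable fun x : ι → E => Function.update x v (x u) := fun u =>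
    (measurable_update' (a := v)).comp (measurable_id.prodMk (measurable_pi_apply u))
  -- The unnormalized law after redrawing coordinate `v`: a fresh draw with weight `θ`, a copy of
  -- each other coordinate in its layer with weight `1`. The claim is that redrawing preserves `ν`
  -- up to total weight, which need only be checked on rectangles.
  let ν' : Measure (ι → E) :=
    ENNReal.ofReal θ • ((G (lay v)).prod ν).map (fun p => Function.update p.2 v p.1) +
      ∑ u ∈ S, ν.map fun x => Function.update x v (x u)
  have hν' : ∀ {D : Set (ι → E)}, MeasurableSet D → ν' D =
      ENNReal.ofReal θ * ∫⁻ y, ν {x | Function.update x v y ∈ D} ∂G (lay v) +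
        ∑ u ∈ S, ν {x | Function.update x v (x u) ∈ D} := by
    intro D hD
    simp only [ν', Measure.add_apply, Measure.smul_apply, smul_eq_mul, Measure.coe_finsetSum,
      Finset.sum_apply]
    rw [Measure.map_apply hm1 hD, Measure.prod_apply (hm1 hD)]
    simp_rw [Measure.map_apply (hm2 _) hD]
    rfl
  have heq : ENNReal.ofReal (θ + S.card) • ν = ν' := by
    have : IsFiniteMeasure (ENNReal.ofReal (θ + S.card) • ν) := ν.smul_finite ENNReal.ofReal_ne_top
    refine Measure.ext_of_univ_pi fun A hA => ?_
    have hA' : ∀ i, MeasurableSet (Function.update A v Set.univ i) := by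
      intro i
      rcases eq_or_ne i v with rfl | hi
      · simp
      · simpa [hi] using hA i
    rw [hν' (MeasurableSet.univ_pi hA), Measure.smul_apply, smul_eq_mul, hν A hA,
      lintegral_prod_layers_predictive hQ hind hθ lay v hA]
    congr 1
    · have : ∀ y, ν {x | Function.update x v y ∈ Set.univ.pi A} =
          (A v).indicator (fun _ => ν (Set.univ.pi (Function.update A v Set.univ))) y := by
        intro y
        by_cases hy : y ∈ A v
        · rw [Set.indicator_of_mem hy]
          congr 1
          ext x
          simp only [Set.mem_ofPred_eq, Set.mem_univ_pi]
          refine forall_congr' fun i => ?_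
          rcases eq_or_ne i v with rfl | hi
          · simpa using hy
          · simp [hi]
        · rw [Set.indicator_of_notMem hy]
          convert measure_empty (μ := ν)
          refine Set.eq_empty_of_forall_notMem fun x hx => hy ?_
          simpa using hx v (Set.mem_univ v)
      rw [lintegral_congr this, lintegral_indicator_const (hA v), hν _ hA', mul_assoc,
        mul_comm (G _ _)]
    · refine Finset.sum_congr rfl fun u hu => ?_
      have huv : u ≠ v := (Finset.mem_filter.1 hu).2.1
      rw [← hν]
      · congr 1
        ext x
        simp only [Set.mem_ofPred_eq, Set.mem_univ_pi]
        refine ⟨fun h i => ?_, fun h i => ?_⟩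
        · have h1 := h u
          rw [Function.update_self] at h1
          rcases eq_or_ne i v with rfl | hv
          · simpa using h1.2
          · rcases eq_or_ne i u with rfl | hi
            · simpa [hv] using h1.1
            · simpa [hv, hi] using h i
        · rcases eq_or_ne i u with rfl | hi
          · rw [Function.update_self]
            exact ⟨by simpa [huv] using h i, by simpa using h v⟩
          · rcases eq_or_ne i v with rfl | hv
            · simp [hi]
            · simpa [hv, hi] using h i
      · intro i
        rcases eq_or_ne i u with rfl | hi
        · simpa using (hA _).inter (hA v)
        · rw [Function.update_of_ne hi]; exact hA' i
  rw [← hν' hD, ← heq, Measure.smul_apply, smul_eq_mul]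

end

/-! ### Labels in order of appearance -/

/-- Both images are the quotient of `s` by the same relation; chosen preimages give the bijection.
-/
lemma ncard_image_congr {ι α β : Type*} {s : Set ι} {f : ι → α} {g : ι → β}
    (h : ∀ a ∈ s, ∀ b ∈ s, f a = f b ↔ g a = g b) : (f '' s).ncard = (g '' s).ncard := by
  refine Set.ncard_congr' ⟨fun y => ⟨g y.2.choose, y.2.choose, y.2.choose_spec.1, rfl⟩,
    fun y => ⟨f y.2.choose, y.2.choose, y.2.choose_spec.1, rfl⟩, ?_, ?_⟩
  · rintro ⟨y, hy⟩
    refine Subtype.ext ?_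
    have h1 := hy.choose_spec
    simp only
    generalize_proofs _ h2
    exact ((h _ h2.choose_spec.1 _ h1.1).2 h2.choose_spec.2).trans h1.2
  · rintro ⟨y, hy⟩
    refine Subtype.ext ?_
    have h1 := hy.choose_spec
    simp only
    generalize_proofs _ h2
    exact ((h _ h2.choose_spec.1 _ h1.1).1 h2.choose_spec.2).trans h1.2

lemma card_image_congr {ι α β : Type*} [DecidableEq α] [DecidableEq β] {s : Finset ι} {f : ι → α}
    {g : ι → β} (h : ∀ a ∈ s, ∀ b ∈ s, f a = f b ↔ g a = g b) :
    (s.image f).card = (s.image g).card := by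
  rw [← Set.ncard_coe_finset, ← Set.ncard_coe_finset, Finset.coe_image, Finset.coe_image]
  exact ncard_image_congr h

section OrderLabel

variable {ι α β : Type*} [LinearOrder ι] {S : Set ι} {f : ι → α} {g : ι → β} {i i' : ι}

/-- Both the condition of preceding the first appearance and the number of distinct values depend
only on ties. -/
lemma orderLabel_congr
    (h : ∀ a ∈ insert i S, ∀ b ∈ insert i S, f a = f b ↔ g a = g b) :
    orderLabel S f i = orderLabel S g i := by
  have hset : {k | k ∈ S ∧ ∀ m ∈ S, f m = f i → k < m} =
      {k | k ∈ S ∧ ∀ m ∈ S, g m = g i → k < m} := by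
    ext k
    refine and_congr_right fun _ => forall₂_congr fun m hm => ?_
    rw [h m (Set.mem_insert_of_mem _ hm) i (Set.mem_insert _ _)]
  unfold orderLabel
  rw [hset]
  congr 1
  exact ncard_image_congr fun a ha b hb =>
    h a (Set.mem_insert_of_mem _ ha.1) b (Set.mem_insert_of_mem _ hb.1)

lemma orderLabel_congr_of_eqOn {f' : ι → α} (h : ∀ a ∈ insert i S, f a = f' a) :
    orderLabel S f i = orderLabel S f' i :=
  orderLabel_congr fun a ha b hb => by rw [h a ha, h b hb]

lemma orderLabel_eq_of_eq (h : f i = f i') : orderLabel S f i = orderLabel S f i' := by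
  unfold orderLabel
  rw [h]

lemma one_le_orderLabel : 1 ≤ orderLabel S f i := Nat.le_add_left _ _

lemma orderLabel_of_forall_ne (h : ∀ m ∈ S, f m ≠ f i) :
    orderLabel S f i = (f '' S).ncard + 1 := by
  unfold orderLabel
  congr 3
  ext k
  exact ⟨fun hk => hk.1, fun hk => ⟨hk, fun m hm hmi => absurd hmi (h m hm)⟩⟩

variable [Finite ι]

lemma orderLabel_le (hi : i ∈ S) : orderLabel S f i ≤ (f '' S).ncard := by
  refine Nat.succ_le_of_lt (Set.ncard_lt_ncard ?_ (Set.toFinite _))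
  refine ⟨Set.image_mono fun k hk => hk.1, fun hsub => ?_⟩
  obtain ⟨k, hk, hki⟩ := hsub ⟨i, hi, rfl⟩
  exact lt_irrefl k (hk.2 k hk.1 hki)

/-- Values appearing before `f i` also appear before `f i'`, and the value at `p` is counted for
`i'` but not for `i`. If `f i'` never appears in `S`, then `hlt` is vacuous. -/
lemma orderLabel_lt {p : ι} (hp : p ∈ S) (hpi : f p = f i) (hlt : ∀ m ∈ S, f m = f i' → p < m) : orderLabel S f i < orderLabel S f i' := by
  refine Nat.succ_lt_succ (Set.ncard_lt_ncard ?_ (Set.toFinite _))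
  refine ⟨Set.image_mono fun k hk => ⟨hk.1, fun m hm hmi => (hk.2 p hp hpi).trans (hlt m hm hmi)⟩,
    fun hsub => ?_⟩
  obtain ⟨k, hk, hkp⟩ := hsub ⟨p, ⟨hp, hlt⟩, rfl⟩
  exact lt_irrefl k (hk.2 k hk.1 (hkp.trans hpi))

lemma exists_first_appearance (hi : ∃ m ∈ S, f m = f i) :
    ∃ p ∈ S, f p = f i ∧ ∀ m ∈ S, f m = f i → p ≤ m := by
  obtain ⟨p, hp, hmin⟩ := Set.exists_min_image {m | m ∈ S ∧ f m = f i} id (Set.toFinite _) hi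
  exact ⟨p, hp.1, hp.2, fun m hm hmi => hmin m ⟨hm, hmi⟩⟩

/-- Distinct values have distinct first appearances, which order the labels. Only `i` must lie in
`S`: with `i' = v` this compares the label of the removed node with those of the others. -/
lemma orderLabel_eq_iff (hi : i ∈ S) : orderLabel S f i = orderLabel S f i' ↔ f i = f i' := by
  refine ⟨fun h => ?_, orderLabel_eq_of_eq⟩
  by_contra hne
  obtain ⟨p, hp, hpi, hmin⟩ := exists_first_appearance (f := f) ⟨i, hi, rfl⟩
  by_cases hi' : ∃ m ∈ S, f m = f i'
  · obtain ⟨p', hp', hpi', hmin'⟩ := exists_first_appearance hi'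
    have hpp : p ≠ p' := by
      rintro rfl
      exact hne (hpi.symm.trans hpi')
    rcases lt_or_gt_of_ne hpp with hlt | hlt
    · exact (orderLabel_lt hp hpi fun m hm hmi => hlt.trans_le (hmin' m hm hmi)).ne h
    · exact (orderLabel_lt hp' hpi' fun m hm hmi => hlt.trans_le (hmin m hm hmi)).ne h.symm
  · push Not at hi'
    exact (orderLabel_lt hp hpi fun m hm hmi => absurd hmi (hi' m hm)).ne h

lemma ncard_image_orderLabel : (orderLabel S f '' S).ncard = (f '' S).ncard :=
  ncard_image_congr fun _ ha _ _ => orderLabel_eq_iff ha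

end OrderLabel

/-- The label factors through the matrix of ties, which takes finitely many values and is measurable
because the diagonal is. -/
lemma measurable_orderLabel {ι E : Type*} [LinearOrder ι] [Finite ι] [MeasurableSpace E]
    [MeasurableEq E] (S : Set ι) (i : ι) : Measurable fun f : ι → E => orderLabel S f i := by
  let tie : (ι → E) → ι → ι → Prop := fun f a b => f a = f b
  have htie : Measurable tie := measurable_pi_lambda _ fun a => measurable_pi_lambda _ fun b =>
    measurableSet_setOfPred.1 (measurableSet_eq_fun (measurable_pi_apply a) (measurable_pi_apply b))
  have hfac : Function.FactorsThrough (fun f : ι → E => orderLabel S f i) tie := fun f g h =>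
    orderLabel_congr fun a _ b _ => iff_of_eq (congrFun (congrFun h a) b)
  have : (fun f : ι → E => orderLabel S f i) =
      Function.extend tie (fun f : ι → E => orderLabel S f i) (fun _ => 0) ∘ tie :=
    funext fun f => (hfac.extend_apply _ f).symm
  rw [this]
  exact (measurable_of_finite _).comp htie

lemma measurableEq_of_standardBorel (E : Type*) [MeasurableSpace E] [StandardBorelSpace E] :
    MeasurableEq E := by
  let := upgradeStandardBorel E
  exact ⟨isClosed_diagonal.measurableSet⟩

/-- The predictive rule for diffuse base measures, for an event `D` that becomes `D'` when item `v`
is drawn afresh. -/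
theorem predictive_rule_of_diffuse {Ω E ι J : Type*} [MeasurableSpace Ω] [MeasurableSpace E]
    {μ : Measure Ω} [Fintype ι] [DecidableEq ι] [Fintype J] [DecidableEq J]
    {Q : J → Ω → Measure E} {θ : ℝ} {G : J → Measure E}
    (hQ : ∀ j, IsDirichletProcess μ (Q j) θ (G j))
    (hind : iIndepFun Q μ) (hθ : 0 < θ) [∀ j, IsProbabilityMeasure (G j)]
    [∀ j, NullSingletonClass (G j)]
    (lay : ι → J) (v : ι) (ν : Measure (ι → E)) [IsFiniteMeasure ν]
    (hν : ∀ A : ι → Set E, (∀ i, MeasurableSet (A i)) →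
      ν (Set.univ.pi A) = ∫⁻ ω, ∏ u, Q (lay u) ω (A u) ∂μ)
    {D D' : Set (ι → E)} (hD : MeasurableSet D) (hD' : MeasurableSet D')
    (hDD' : ∀ x y, (∀ u, x u ≠ y) → (Function.update x v y ∈ D ↔ x ∈ D')) :
    ENNReal.ofReal (θ + (Finset.univ.filter fun u => u ≠ v ∧ lay u = lay v).card) * ν D =
      ENNReal.ofReal θ * ν D' +
        ∑ u ∈ Finset.univ.filter (fun u => u ≠ v ∧ lay u = lay v),
          ν {x | Function.update x v (x u) ∈ D} := by
  rw [predictive_rule hQ hind hθ lay v ν hν hD]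
  congr 2
  have hm : Measurable fun p : E × (ι → E) => Function.update p.2 v p.1 :=
    (measurable_update' (a := v)).comp measurable_swap
  have h1 := Measure.prod_apply (μ := G (lay v)) (ν := ν) (hm hD)
  -- The order of integration is exchanged so that `x` is fixed first: its finitely many values form
  -- a null set for the diffuse law of the fresh draw.
  rw [Measure.prod_apply_symm (hm hD)] at h1
  refine h1.symm.trans ?_
  rw [← lintegral_indicator_one hD']
  refine lintegral_congr fun x => ?_
  have hae : ∀ᵐ y ∂G (lay v), ∀ u, x u ≠ y := by
    refine ae_all_iff.2 fun u => ?_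
    rw [ae_iff]
    simp [eq_comm]
  by_cases hx : x ∈ D'
  · rw [Set.indicator_of_mem hx, Pi.one_apply, ← measure_univ (μ := G (lay v))]
    refine measure_congr (hae.mono fun y hy => propext ?_)
    exact ⟨fun _ => trivial, fun _ => (hDD' x y hy).2 hx⟩
  · rw [Set.indicator_of_notMem hx, ← measure_empty (μ := G (lay v))]
    refine measure_congr (hae.mono fun y hy => propext ?_)
    exact ⟨fun h => hx ((hDD' x y hy).1 h), fun h => h.elim⟩

/-! ### The groups, given the subgroups -/

lemma numGroups_orderLabel {N : ℕ} {α : Type*} (v : Fin N) (f : Fin N → α) :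
    numGroups (fun u : {u : Fin N // u ≠ v} => orderLabel {k | k ≠ v} f u) =
      (f '' {k | k ≠ v}).ncard := by
  rw [numGroups, ← ncard_image_orderLabel, ← Set.ncard_coe_finset]
  congr 1
  ext n
  simp

section Root

variable {Ω X K : Type*} [MeasurableSpace Ω] [MeasurableSpace X] {μ : Measure Ω}
  {P₀ : Ω → Measure X} {θ₀ : ℝ} {G₀ : Measure X} {ν : Measure (K → X)}

/-- Coordinates outside the range of `φ` are left unconstrained and contribute the factor `1`. -/
lemma map_comp_apply_univ_pi [Fintype K] (hP : IsDirichletProcess μ P₀ θ₀ G₀)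
    (hν : ∀ B : K → Set X, (∀ k, MeasurableSet (B k)) →
      ν (Set.univ.pi B) = ∫⁻ ω, ∏ k, P₀ ω (B k) ∂μ)
    {R : Type*} [Fintype R] {φ : R → K} (hφ : Function.Injective φ)
    {B : R → Set X} (hB : ∀ r, MeasurableSet (B r)) :
    ν.map (fun x r => x (φ r)) (Set.univ.pi B) = ∫⁻ ω, ∏ r, P₀ ω (B r) ∂μ := by
  have hprob := hP.isProbabilityMeasure
  have hext : ∀ k, MeasurableSet (Function.extend φ B (fun _ => Set.univ) k) := by
    intro k
    by_cases hk : ∃ r, φ r = k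
    · obtain ⟨r, rfl⟩ := hk
      rw [hφ.extend_apply]
      exact hB r
    · rw [Function.extend_apply' _ _ _ hk]
      exact MeasurableSet.univ
  rw [Measure.map_apply (by fun_prop) (MeasurableSet.univ_pi hB)]
  have hpre : (fun (x : K → X) r => x (φ r)) ⁻¹' Set.univ.pi B =
      Set.univ.pi (Function.extend φ B fun _ => Set.univ) := by
    ext x
    simp only [Set.mem_preimage, Set.mem_univ_pi]
    refine ⟨fun h k => ?_, fun h r => ?_⟩
    · by_cases hk : ∃ r, φ r = k
      · obtain ⟨r, rfl⟩ := hk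
        rw [hφ.extend_apply]
        exact h r
      · rw [Function.extend_apply' _ _ _ hk]
        trivial
    · simpa [hφ.extend_apply] using h (φ r)
  rw [hpre, hν _ hext]
  refine lintegral_congr fun ω => (Fintype.prod_of_injective φ hφ _ _ (fun k hk => ?_)
    fun r => ?_).symm
  · rw [Function.extend_apply' _ _ _ hk, measure_univ]
  · rw [hφ.extend_apply]

/-- Exchangeability: the law of an array of draws from the root depends only on the ties among
the indices. -/
lemma map_comp_eq_of_ties [Fintype K] [IsFiniteMeasure ν] (hP : IsDirichletProcess μ P₀ θ₀ G₀)
    (hν : ∀ B : K → Set X, (∀ k, MeasurableSet (B k)) →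
      ν (Set.univ.pi B) = ∫⁻ ω, ∏ k, P₀ ω (B k) ∂μ)
    {U : Type*} {κ κ' : U → K} (hκ : ∀ u u', κ u = κ u' ↔ κ' u = κ' u') :
    ν.map (fun x u => x (κ u)) = ν.map (fun x u => x (κ' u)) := by
  classical
  -- Equal ties mean that `κ'` is `κ` followed by an injection `φ'` of its range. The two arrays are
  -- then the same duplication of subarrays with equal laws.
  let φ' : Set.range κ → K := fun r => κ' r.2.choose
  have hφ' : Function.Injective φ' := fun r r' h => by
    have := (hκ _ _).2 h
    rw [r.2.choose_spec, r'.2.choose_spec] at this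
    exact Subtype.ext this
  have hval : ∀ u, φ' ⟨κ u, u, rfl⟩ = κ' u := fun u => by
    have h : ∃ a, κ a = κ u := ⟨u, rfl⟩
    exact (hκ _ _).1 h.choose_spec
  have heq : ν.map (fun x (r : Set.range κ) => x r) = ν.map (fun x r => x (φ' r)) :=
    Measure.ext_of_univ_pi fun B hB => by
      rw [map_comp_apply_univ_pi hP hν Subtype.val_injective hB,
        map_comp_apply_univ_pi hP hν hφ' hB]
  have hm : Measurable fun (y : Set.range κ → X) (u : U) => y ⟨κ u, u, rfl⟩ := by fun_prop
  have := congrArg (fun ρ => ρ.map fun (y : Set.range κ → X) (u : U) => y ⟨κ u, u, rfl⟩) heq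
  rw [Measure.map_map hm (by fun_prop), Measure.map_map hm (by fun_prop)] at this
  simpa only [Function.comp_def, hval] using this

variable {N : ℕ} {v : Fin N} {z : {u : Fin N // u ≠ v} → ℕ}

/-- The event that the groups of the nodes other than `v` are given by `z`, when node `u` belongs
to the subgroup with index `κ u`. -/
def groupsEvent (X : Type*) (v : Fin N) (κ : Fin N → K) (z : {u : Fin N // u ≠ v} → ℕ) :
    Set (K → X) :=
  {x | (fun u : {u : Fin N // u ≠ v} => orderLabel {k | k ≠ v} (fun k => x (κ k)) u) = z}

lemma measurableSet_groupsEvent [MeasurableEq X] (κ : Fin N → K) :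
    MeasurableSet (groupsEvent X v κ z) :=
  measurableSet_eq_fun (measurable_pi_lambda _ fun u =>
    (measurable_orderLabel {k | k ≠ v} (u : Fin N)).comp (by fun_prop)) measurable_const

/-- The event reads only nodes other than `v`, so only ties among their indices matter. This absorbs
the renumbering of subgroups caused by removing `v`. -/
lemma measure_groupsEvent_congr [Fintype K] [MeasurableEq X] [Nonempty X] [IsFiniteMeasure ν]
    (hP : IsDirichletProcess μ P₀ θ₀ G₀)
    (hν : ∀ B : K → Set X, (∀ k, MeasurableSet (B k)) →
      ν (Set.univ.pi B) = ∫⁻ ω, ∏ k, P₀ ω (B k) ∂μ)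
    {κ κ' : Fin N → K} (hκ : ∀ u u', u ≠ v → u' ≠ v → (κ u = κ u' ↔ κ' u = κ' u')) :
    ν (groupsEvent X v κ z) = ν (groupsEvent X v κ' z) := by
  classical
  -- An arbitrary value is put at `v`; the labels in the event do not read it.
  let F : ({u : Fin N // u ≠ v} → X) → Fin N → X := fun y k =>
    if hk : k ≠ v then y ⟨k, hk⟩ else Classical.arbitrary X
  have hF : Measurable F := by
    refine measurable_pi_lambda _ fun k => ?_
    by_cases hk : k ≠ v
    · simpa [F, hk] using measurable_pi_apply _
    · simpa only [F, hk, dite_false] using measurable_const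
  let D : Set ({u : Fin N // u ≠ v} → X) :=
    {y | (fun u : {u : Fin N // u ≠ v} => orderLabel {k | k ≠ v} (F y) u) = z}
  have hD : MeasurableSet D := measurableSet_eq_fun (measurable_pi_lambda _ fun u =>
    (measurable_orderLabel {k | k ≠ v} (u : Fin N)).comp hF) measurable_const
  have hpre : ∀ κ : Fin N → K, ν (groupsEvent X v κ z) =
      ν.map (fun x (u : {u : Fin N // u ≠ v}) => x (κ u)) D := by
    intro κ
    rw [Measure.map_apply (by fun_prop) hD]
    congr 1
    ext x
    refine Eq.congr_left (funext fun u => orderLabel_congr_of_eqOn fun a ha => ?_)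
    have hav : a ≠ v := by
      rcases ha with rfl | ha
      · exact u.2
      · exact ha
    simp [F, hav]
  have hties := map_comp_eq_of_ties hP hν (U := {u : Fin N // u ≠ v}) (κ := fun u => κ u)
    (κ' := fun u => κ' u) fun u u' => hκ u u' u.2 u'.2
  rw [hpre, hpre, hties]

/-- The group of node `v`, when it starts a new subgroup. -/
lemma measure_groupsEvent_new [Fintype K] [MeasurableEq X] [IsFiniteMeasure ν]
    (hP : IsDirichletProcess μ P₀ θ₀ G₀)
    (hθ₀ : 0 < θ₀) [IsProbabilityMeasure μ] [IsProbabilityMeasure G₀] [NullSingletonClass G₀]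
    (hν : ∀ B : K → Set X, (∀ k, MeasurableSet (B k)) →
      ν (Set.univ.pi B) = ∫⁻ ω, ∏ k, P₀ ω (B k) ∂μ) [DecidableEq K]
    {κ : Fin N → K} (hκ : ∀ u, u ≠ v → κ u ≠ κ v)
    (hz : ∀ u u' : {u : Fin N // u ≠ v}, κ u = κ u' → z u = z u') (h : ℕ) :
    ENNReal.ofReal (θ₀ + (Finset.univ.image fun u : {u : Fin N // u ≠ v} => κ u).card) *
        ν (groupsEvent X v κ z ∩ {x | orderLabel {k | k ≠ v} (fun k => x (κ k)) v = h}) =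
      (ENNReal.ofReal θ₀ * (if h = numGroups z + 1 then 1 else 0) +
        ((Finset.univ.filter fun u => z u = h).image
          fun u : {u : Fin N // u ≠ v} => κ u).card) * ν (groupsEvent X v κ z) := by
  classical
  -- Restricting to indices in use makes the root sample contain one draw per actual subgroup;
  -- unused profiles would otherwise enter the urn counts.
  let κR : Fin N → Set.range κ := fun u => ⟨κ u, u, rfl⟩
  let νR := ν.map fun x (r : Set.range κ) => x r
  have hνR : ∀ B : Set.range κ → Set X, (∀ k, MeasurableSet (B k)) →
      νR (Set.univ.pi B) = ∫⁻ ω, ∏ k, P₀ ω (B k) ∂μ := fun B hB =>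
    map_comp_apply_univ_pi hP hν Subtype.val_injective hB
  let D₀ := groupsEvent X v κR z
  let D := D₀ ∩ {y | orderLabel {k | k ≠ v} (fun k => y (κR k)) v = h}
  let D' := D₀ ∩ {_y | h = numGroups z + 1}
  have hD₀ : MeasurableSet D₀ := measurableSet_groupsEvent κR
  have hD : MeasurableSet D := hD₀.inter
    (measurableSet_eq_fun ((measurable_orderLabel _ v).comp (by fun_prop)) measurable_const)
  have hD' : MeasurableSet D' := hD₀.inter (MeasurableSet.const _)
  have hm : Measurable fun (x : K → X) (r : Set.range κ) => x r := by fun_prop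
  have hνD : ν (groupsEvent X v κ z ∩ {x | orderLabel {k | k ≠ v} (fun k => x (κ k)) v = h}) =
      νR D := (Measure.map_apply hm hD).symm
  have hνD₀ : ν (groupsEvent X v κ z) = νR D₀ := (Measure.map_apply hm hD₀).symm
  have hκR : ∀ u, u ≠ v → κR u ≠ κR v := fun u hu hh => hκ u hu (congrArg Subtype.val hh)
  have hupd : ∀ x y, Function.update x (κR v) y ∈ D₀ ↔ x ∈ D₀ := by
    intro x y
    refine Eq.congr_left (funext fun u => orderLabel_congr_of_eqOn fun a ha => ?_)
    have hav : a ≠ v := by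
      rcases ha with rfl | ha
      · exact u.2
      · exact ha
    simp [hκR a hav]
  have hgroups : ∀ x ∈ D₀, numGroups z = ((fun k => x (κR k)) '' {k | k ≠ v}).ncard := by
    intro x hx
    rw [← numGroups_orderLabel]
    exact congrArg numGroups (Eq.symm hx)
  have hDD' : ∀ x y, (∀ r, x r ≠ y) → (Function.update x (κR v) y ∈ D ↔ x ∈ D') := by
    intro x y hy
    have hne : ∀ k, k ≠ v → Function.update x (κR v) y (κR k) = x (κR k) := fun k hk =>
      Function.update_of_ne (hκR k hk) _ _
    have hlab : orderLabel {k | k ≠ v} (fun k => Function.update x (κR v) y (κR k)) v =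
        ((fun k => x (κR k)) '' {k | k ≠ v}).ncard + 1 := by
      rw [orderLabel_of_forall_ne fun m hm => ?_, Set.image_congr (s := {k | k ≠ v}) hne]
      simpa [hne m hm] using hy (κR m)
    refine ⟨fun hx => ?_, fun hx => ?_⟩
    · have hx₀ := (hupd x y).1 hx.1
      exact ⟨hx₀, by rw [hgroups x hx₀, ← hlab]; exact hx.2.symm⟩
    · refine ⟨(hupd x y).2 hx.1, hlab.trans ?_⟩
      rw [← hgroups x hx.1]
      exact hx.2.symm
  have key := predictive_rule_of_diffuse (J := Unit) (Q := fun _ => P₀) (G := fun _ => G₀)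
    (fun _ => hP) iIndepFun.of_subsingleton hθ₀ (fun _ => ()) (κR v) νR hνR hD hD' hDD'
  -- Copying the profile of subgroup `r` puts `v` in the group of any node of `r`; `hz` makes this
  -- group independent of the node chosen.
  have hcopy : ∀ r ∈ Finset.univ.filter (fun r => r ≠ κR v ∧ () = ()),
      νR {x | Function.update x (κR v) (x r) ∈ D} =
        if ∃ u : {u : Fin N // u ≠ v}, κR u = r ∧ z u = h then νR D₀ else 0 := by
    intro r hr
    obtain ⟨_, u, rfl⟩ := r
    have huv : u ≠ v := by
      rintro rfl
      exact (Finset.mem_filter.1 hr).2.1 rfl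
    have hlab : ∀ x ∈ D₀, orderLabel {k | k ≠ v}
        (fun k => Function.update x (κR v) (x (κR u)) (κR k)) v = z ⟨u, huv⟩ := by
      intro x hx
      rw [orderLabel_eq_of_eq (i' := u) (by simp [hκR u huv])]
      exact congrFun ((hupd x (x (κR u))).2 hx) ⟨u, huv⟩
    have hiff : (∃ u' : {u : Fin N // u ≠ v}, κR u' = κR u ∧ z u' = h) ↔ z ⟨u, huv⟩ = h :=
      ⟨fun ⟨u', h1, h2⟩ => (hz _ _ (congrArg Subtype.val h1)).symm.trans h2,
        fun h1 => ⟨⟨u, huv⟩, rfl, h1⟩⟩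
    have hset : {x | Function.update x (κR v) (x (κR u)) ∈ D} =
        if z ⟨u, huv⟩ = h then D₀ else ∅ := by
      ext x
      have h1 : Function.update x (κR v) (x (κR u)) ∈ D ↔ x ∈ D₀ ∧ z ⟨u, huv⟩ = h := by
        refine ⟨fun hx => ?_, fun hx => ?_⟩
        · have hx₀ := (hupd x _).1 hx.1
          exact ⟨hx₀, (hlab x hx₀).symm.trans hx.2⟩
        · exact ⟨(hupd x _).2 hx.1, (hlab x hx.1).trans hx.2⟩
      split_ifs with hzh <;> simpa [hzh] using h1
    rw [if_congr hiff rfl rfl]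
    change νR {x | Function.update x (κR v) (x (κR u)) ∈ D} = _
    rw [hset]
    split_ifs <;> simp
  have hcard : (Finset.univ.filter fun r => r ≠ κR v ∧ () = ()).card =
      (Finset.univ.image fun u : {u : Fin N // u ≠ v} => κ u).card := by
    rw [card_image_congr (g := fun u : {u : Fin N // u ≠ v} => κR u) fun a _ b _ =>
      Subtype.ext_iff.symm]
    congr 1
    ext ⟨_, u, rfl⟩
    simp only [and_true, Finset.mem_filter, Finset.mem_univ, true_and, Finset.mem_image]
    refine ⟨fun hu => ⟨⟨u, by rintro rfl; exact hu rfl⟩, rfl⟩, ?_⟩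
    rintro ⟨u', hu'⟩
    rw [← hu']
    exact hκR u' u'.2
  have hcard' : ((Finset.univ.filter fun r => r ≠ κR v ∧ () = ()).filter fun r =>
      ∃ u : {u : Fin N // u ≠ v}, κR u = r ∧ z u = h).card =
      ((Finset.univ.filter fun u => z u = h).image
          fun u : {u : Fin N // u ≠ v} => κ u).card := by
    rw [card_image_congr (g := fun u : {u : Fin N // u ≠ v} => κR u) fun a _ b _ =>
      Subtype.ext_iff.symm]
    congr 1
    ext r
    simp only [and_true, Finset.mem_filter, Finset.mem_univ, true_and, Finset.mem_image]
    refine ⟨fun ⟨_, u, h1, h2⟩ => ⟨u, h2, h1⟩, ?_⟩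
    rintro ⟨u, h1, rfl⟩
    exact ⟨hκR u u.2, u, rfl, h1⟩
  rw [Finset.sum_congr rfl hcopy, ← Finset.sum_filter, Finset.sum_const, hcard', hcard,
    nsmul_eq_mul] at key
  rw [hνD, hνD₀, key, add_mul, mul_assoc]
  congr 2
  split_ifs with hh <;> simp [D', hh]

end Root

/-! ### The subgroups -/

section Subgroups

variable {N d : ℕ} {T : Type*} (lay : Fin N → Fin d) (v : Fin N)

lemma layerSize_eq_card_add_one :
    layerSize lay (lay v) =
      (Finset.univ.filter fun u => u ≠ v ∧ lay u = lay v).card + 1 := by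
  rw [layerSize, ← Finset.card_insert_of_notMem (a := v) (by simp)]
  congr 1
  ext u
  by_cases h : u = v <;> simp [h]

/-- Keeps the label within the range of profiles whose law is prescribed by `conditional_law`. -/
lemma subgroupLabel_le_layerSize (t : Fin N → T) (u : Fin N) :
    subgroupLabel lay t u ≤ layerSize lay (lay u) := by
  refine (orderLabel_le (by rfl)).trans ((Set.ncard_image_le (Set.toFinite _)).trans_eq ?_)
  rw [layerSize, ← Set.ncard_coe_finset]
  congr 1
  ext k
  simp

/-- The indices of the subgroup profiles that can be in use. -/
abbrev SubgroupIndex := (j : Fin d) × Finset.Icc 1 (layerSize lay j)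

/-- The index of the subgroup of node `u`. -/
noncomputable def subgroupIndex (t : Fin N → T) (u : Fin N) : SubgroupIndex lay :=
  ⟨lay u, subgroupLabel lay t u,
    Finset.mem_Icc.2 ⟨one_le_orderLabel, subgroupLabel_le_layerSize lay t u⟩⟩

variable {lay v}

lemma subgroupIndex_eq_iff {t : Fin N → T} {u u' : Fin N} :
    subgroupIndex lay t u = subgroupIndex lay t u' ↔ lay u = lay u' ∧ t u = t u' := by
  have hiff : lay u = lay u' →
      (subgroupLabel lay t u = subgroupLabel lay t u' ↔ t u = t u') := fun h => by
    unfold subgroupLabel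
    rw [← h]
    exact orderLabel_eq_iff (by rfl)
  refine ⟨fun h => ?_, fun h => ?_⟩
  · have h1 : lay u = lay u' := congrArg Sigma.fst h
    have h2 : subgroupLabel lay t u = subgroupLabel lay t u' :=
      congrArg (fun k : SubgroupIndex lay => (k.2 : ℕ)) h
    exact ⟨h1, (hiff h1).1 h2⟩
  · have h2 := (hiff h.1).2 h.2
    refine Sigma.ext h.1 ?_
    rw [Subtype.heq_iff_coe_eq]
    · exact h2
    · intro n
      simp [subgroupIndex, h.1]

lemma wMinus_eq_iff {t : Fin N → T} {u u' : {u : Fin N // u ≠ v}} (h : lay u = lay u') :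
    wMinus lay t v u = wMinus lay t v u' ↔ t u = t u' := by
  unfold wMinus
  rw [← h]
  exact orderLabel_eq_iff ⟨rfl, u.2⟩

lemma wMinus_eq_wNode_iff {t : Fin N → T} {u : {u : Fin N // u ≠ v}} (h : lay u = lay v) :
    wMinus lay t v u = wNode lay t v ↔ t u = t v := by
  unfold wMinus wNode
  rw [h]
  exact orderLabel_eq_iff ⟨h, u.2⟩

lemma numSubgroups_wMinus (t : Fin N → T) :
    numSubgroups (fun u : {u : Fin N // u ≠ v} => lay u) (wMinus lay t v) (lay v) =
      (t '' {k | lay k = lay v ∧ k ≠ v}).ncard := by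
  rw [numSubgroups, ← ncard_image_orderLabel, ← Set.ncard_coe_finset]
  congr 1
  ext n
  simp only [Finset.coe_image, Finset.coe_filter, Finset.mem_univ, true_and, Set.mem_image,
    Set.mem_ofPred_eq, Subtype.exists, wMinus]
  constructor
  · rintro ⟨u, hu, h, rfl⟩
    exact ⟨u, ⟨h, hu⟩, by rw [h]⟩
  · rintro ⟨u, ⟨h, hu⟩, rfl⟩
    exact ⟨u, hu, h, by rw [h]⟩

lemma wMinus_le_numSubgroups {t : Fin N → T} {u : {u : Fin N // u ≠ v}} (h : lay u = lay v) :
    wMinus lay t v u ≤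
      numSubgroups (fun u : {u : Fin N // u ≠ v} => lay u) (wMinus lay t v) (lay v) := by
  rw [numSubgroups_wMinus]
  unfold wMinus
  rw [h]
  exact orderLabel_le ⟨h, u.2⟩

lemma measurable_wMinus [MeasurableSpace T] [MeasurableEq T] :
    Measurable fun t : Fin N → T => wMinus lay t v :=
  measurable_pi_lambda _ fun _ => measurable_orderLabel _ _

lemma measurable_wNode [MeasurableSpace T] [MeasurableEq T] :
    Measurable fun t : Fin N → T => wNode lay t v := measurable_orderLabel _ _

/-- Subgroup labels restart in each layer, so a subgroup is identified by its layer and label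
together. -/
lemma card_image_pair {U : Type*} [DecidableEq U] (F : Finset U) (lay : U → Fin d) (w : U → ℕ) :
    (F.image fun u => (lay u, w u)).card = ∑ j, ((F.filter fun u => lay u = j).image w).card := by
  rw [Finset.card_eq_sum_card_fiberwise (f := Prod.fst) (t := Finset.univ) fun _ _ =>
    Finset.mem_coe.2 (Finset.mem_univ _)]
  refine Finset.sum_congr rfl fun j _ => ?_
  rw [← Finset.card_image_of_injective ((F.filter fun u => lay u = j).image w)
    (Prod.mk_right_injective j)]
  congr 1
  ext ⟨j', n⟩
  simp only [Finset.mem_filter, Finset.mem_image, Prod.mk.injEq]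
  constructor
  · rintro ⟨⟨u, hu, h1, h2⟩, h3⟩
    exact ⟨n, ⟨u, ⟨hu, h1.trans h3⟩, h2⟩, h3.symm, rfl⟩
  · rintro ⟨_, ⟨u, ⟨hu, h1⟩, h2⟩, h3, h4⟩
    exact ⟨⟨u, hu, h1.trans h3, h2.trans h4⟩, h3.symm⟩

/-- The labels `subgroupAt` are distinct, so at most one term survives; if none equals `τ`, the
count on the right is empty. This removes the enumeration of subgroups from the formula. -/
lemma sum_subgroupSize {ι : Type*} [Fintype ι] (lay : ι → Fin d) (z w : ι → ℕ) (j : Fin d)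
    (h τ : ℕ) (c : ℝ) :
    (∑ i, if τ = subgroupAt lay z w j h i then (subgroupSize lay z w j h i : ℝ) / c else 0) =
      (Finset.univ.filter fun u => lay u = j ∧ z u = h ∧ w u = τ).card / c := by
  have hterm : ∀ i, (if τ = subgroupAt lay z w j h i then
      (subgroupSize lay z w j h i : ℝ) / c else 0) = if τ = subgroupAt lay z w j h i then
      ((Finset.univ.filter fun u => lay u = j ∧ z u = h ∧ w u = τ).card : ℝ) / c else 0 := by
    intro i
    split_ifs with hi
    · rw [hi]; rfl
    · rfl
  rw [Finset.sum_congr rfl fun i _ => hterm i]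
  by_cases hmem : τ ∈ subgroupsWith lay z w j h
  · have : τ ∈ Set.range ((subgroupsWith lay z w j h).orderEmbOfFin rfl) := by
      rw [Finset.range_orderEmbOfFin]; exact hmem
    obtain ⟨i, hi⟩ := this
    rw [Finset.sum_eq_single i (fun i' _ hne => if_neg fun h' => hne ?_) (by simp)]
    · exact if_pos hi.symm
    · exact ((subgroupsWith lay z w j h).orderEmbOfFin rfl).injective (h'.symm.trans hi.symm)
  · rw [Finset.sum_eq_zero fun i _ => if_neg ?_]
    · have : (Finset.univ.filter fun u => lay u = j ∧ z u = h ∧ w u = τ) = ∅ := by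
        refine Finset.filter_eq_empty_iff.2 fun u _ hu => hmem ?_
        exact Finset.mem_image.2 ⟨u, Finset.mem_filter.2 ⟨Finset.mem_univ _, hu.1, hu.2.1⟩, hu.2.2⟩
      simp [this]
    · rintro rfl
      exact hmem (Finset.orderEmbOfFin_mem _ _ _)

end Subgroups

/-- The subgroup of node `v`, given the subgroups of the other nodes. -/
lemma measure_wMinus_wNode {N d : ℕ} {Ω T : Type*} [MeasurableSpace Ω] [MeasurableSpace T]
    [MeasurableEq T] {μ : Measure Ω} {lay : Fin N → Fin d} {θ : ℝ} {G : Fin d → Measure T}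
    {Q : Fin d → Ω → Measure T} [∀ j, IsProbabilityMeasure (G j)] [∀ j, NullSingletonClass (G j)]
    (hθ : 0 < θ) (hQ : ∀ j, IsDirichletProcess μ (Q j) θ (G j)) (hind : iIndepFun Q μ)
    (ν : Measure (Fin N → T)) [IsFiniteMeasure ν]
    (hν : ∀ A : Fin N → Set T, (∀ i, MeasurableSet (A i)) →
      ν (Set.univ.pi A) = ∫⁻ ω, ∏ u, Q (lay u) ω (A u) ∂μ)
    (v : Fin N) (w : {u : Fin N // u ≠ v} → ℕ) (τ : ℕ) :
    ENNReal.ofReal (θ + layerSize lay (lay v) - 1) *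
        ν {t | wMinus lay t v = w ∧ wNode lay t v = τ} =
      (ENNReal.ofReal θ * (if τ = numSubgroups (fun u : {u : Fin N // u ≠ v} => lay u) w (lay v) + 1
          then 1 else 0) +
        (Finset.univ.filter fun u : {u : Fin N // u ≠ v} => lay u = lay v ∧ w u = τ).card) *
        ν {t | wMinus lay t v = w} := by
  classical
  let W : Set (Fin N → T) := {t | wMinus lay t v = w}
  let n := numSubgroups (fun u : {u : Fin N // u ≠ v} => lay u) w (lay v)
  have hW : MeasurableSet W := measurableSet_eq_fun measurable_wMinus measurable_const
  let D : Set (Fin N → T) := {t | wMinus lay t v = w ∧ wNode lay t v = τ}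
  let D' : Set (Fin N → T) := W ∩ {_t | τ = n + 1}
  have hD : MeasurableSet D := hW.inter (measurableSet_eq_fun measurable_wNode measurable_const)
  have hD' : MeasurableSet D' := hW.inter (MeasurableSet.const _)
  -- The labels of the others are computed without `v`, hence survive any change of its value.
  have hupd : ∀ (t : Fin N → T) y, wMinus lay (Function.update t v y) v = wMinus lay t v := by
    refine fun t y => funext fun u => orderLabel_congr_of_eqOn fun a ha => ?_
    have hav : a ≠ v := by
      rcases ha with rfl | ha
      · exact u.2
      · exact ha.2
    simp [hav]
  have hDD' : ∀ t y, (∀ u, t u ≠ y) → (Function.update t v y ∈ D ↔ t ∈ D') := by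
    intro t y hy
    have hlab : wNode lay (Function.update t v y) v =
        numSubgroups (fun u : {u : Fin N // u ≠ v} => lay u) (wMinus lay t v) (lay v) + 1 := by
      rw [← hupd t y, numSubgroups_wMinus]
      refine orderLabel_of_forall_ne fun m hm => ?_
      simpa [hm.2] using hy m
    refine ⟨fun ⟨h1, h2⟩ => ?_, fun ⟨h1, h2⟩ => ?_⟩
    · rw [hupd] at h1
      rw [hlab, h1] at h2
      exact ⟨h1, h2.symm⟩
    · refine ⟨(hupd t y).trans h1, hlab.trans ?_⟩
      rw [show wMinus lay t v = w from h1]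
      exact Eq.symm h2
  have key := predictive_rule_of_diffuse hQ hind hθ lay v ν hν hD hD' hDD'
  have hcopy : ∀ u ∈ Finset.univ.filter (fun u => u ≠ v ∧ lay u = lay v),
      ν {t | Function.update t v (t u) ∈ D} =
        if ∃ hu : u ≠ v, w ⟨u, hu⟩ = τ then ν W else 0 := by
    intro u hu
    obtain ⟨huv, hlu⟩ := (Finset.mem_filter.1 hu).2
    have hlab : ∀ t : Fin N → T,
        wNode lay (Function.update t v (t u)) v = wMinus lay t v ⟨u, huv⟩ := by
      intro t
      rw [← hupd t (t u)]
      refine ((wMinus_eq_wNode_iff (u := ⟨u, huv⟩) hlu).2 ?_).symm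
      simp [huv]
    have hmem : ∀ t, Function.update t v (t u) ∈ D ↔ t ∈ W ∧ w ⟨u, huv⟩ = τ := by
      intro t
      refine ⟨fun ⟨h1, h2⟩ => ?_, fun ⟨h1, h2⟩ => ?_⟩
      · rw [hupd] at h1
        rw [hlab, h1] at h2
        exact ⟨h1, h2⟩
      · exact ⟨(hupd t _).trans h1, (hlab t).trans ((congrFun h1 _).trans h2)⟩
    simp_rw [hmem]
    by_cases hwu : w ⟨u, huv⟩ = τ <;> simp [hwu, huv]
  have hcard : ((Finset.univ.filter fun u => u ≠ v ∧ lay u = lay v).filter fun u =>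
      ∃ hu : u ≠ v, w ⟨u, hu⟩ = τ).card =
      (Finset.univ.filter fun u : {u : Fin N // u ≠ v} => lay u = lay v ∧ w u = τ).card := by
    rw [← Finset.card_map (Function.Embedding.subtype _)]
    congr 1
    ext u
    simp only [Finset.mem_filter, Finset.mem_univ, true_and, Finset.mem_map,
      Function.Embedding.subtype_apply, Subtype.exists, exists_and_right, exists_eq_right]
    constructor
    · rintro ⟨⟨h1, h2⟩, h3, h4⟩
      exact ⟨h1, h2, h4⟩
    · rintro ⟨h1, h2, h3⟩
      exact ⟨⟨h1, h2⟩, h1, h3⟩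
  rw [Finset.sum_congr rfl hcopy, ← Finset.sum_filter, Finset.sum_const, hcard,
    nsmul_eq_mul] at key
  rw [layerSize_eq_card_add_one, Nat.cast_succ, ← add_assoc, add_sub_cancel_right]
  refine key.trans ?_
  rw [add_mul, mul_assoc]
  congr 2
  change ν D' = (if τ = n + 1 then 1 else 0) * ν W
  split_ifs with hh <;> simp [D', hh]

/-! ### The joint law of the labels -/

lemma isCountablySpanning_univ_pi {ι E : Type*} [MeasurableSpace E] : IsCountablySpanning
    (Set.univ.pi '' Set.univ.pi fun _ : ι => {s : Set E | MeasurableSet s}) :=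
  ⟨fun _ => Set.univ, fun _ => ⟨fun _ => Set.univ, fun _ _ => MeasurableSet.univ,
    Set.pi_univ _⟩, Set.iUnion_const _⟩

lemma Measure.ext_of_univ_pi_prod {ι κ E F : Type*} [Fintype ι] [Fintype κ] [MeasurableSpace E]
    [MeasurableSpace F] {ρ ρ' : Measure ((ι → E) × (κ → F))} [IsFiniteMeasure ρ]
    (h : ∀ (A : ι → Set E) (B : κ → Set F), (∀ i, MeasurableSet (A i)) →
      (∀ k, MeasurableSet (B k)) →
      ρ (Set.univ.pi A ×ˢ Set.univ.pi B) = ρ' (Set.univ.pi A ×ˢ Set.univ.pi B)) : ρ = ρ' := by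
  refine ext_of_generate_finite _
    (generateFrom_eq_prod generateFrom_pi generateFrom_pi isCountablySpanning_univ_pi
      isCountablySpanning_univ_pi).symm
    (isPiSystem_pi.prod isPiSystem_pi) ?_ ?_
  · rintro _ ⟨_, ⟨A, hA, rfl⟩, _, ⟨B, hB, rfl⟩, rfl⟩
    exact h A B (fun i => hA i (Set.mem_univ i)) fun k => hB k (Set.mem_univ k)
  · simpa using h (fun _ => Set.univ) (fun _ => Set.univ) (fun _ => MeasurableSet.univ)
      fun _ => MeasurableSet.univ

namespace IsHDPScheme

variable {N d : ℕ} {Ω T X : Type*} [MeasurableSpace Ω] [MeasurableSpace T]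
    [MeasurableSpace X] {μ : Measure Ω} {lay : Fin N → Fin d} {θ θ₀ : ℝ}
    {G : Fin d → Measure T} {G₀ : Measure X}
    {Q : Fin d → Ω → Measure T} {P₀ : Ω → Measure X}
    {t : Fin N → Ω → T} {s : Fin d → ℕ → Ω → X}

lemma measurable_nodes (hs : IsHDPScheme μ lay θ θ₀ G G₀ Q P₀ t s) :
    Measurable fun ω u => t u ω := measurable_pi_lambda _ hs.measurable_t

lemma measurable_profiles (hs : IsHDPScheme μ lay θ θ₀ G G₀ Q P₀ t s) :
    Measurable fun ω (k : SubgroupIndex lay) => s k.1 k.2 ω :=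
  measurable_pi_lambda _ fun k => hs.measurable_s k.1 k.2

/-- Taking no constraint on the random measures in `conditional_law` leaves a function of the layers
times a function of the root, which are independent. -/
lemma measure_rectangle (hs : IsHDPScheme μ lay θ θ₀ G G₀ Q P₀ t s)
    {A : Fin N → Set T} {B : SubgroupIndex lay → Set X} (hA : ∀ u, MeasurableSet (A u))
    (hB : ∀ k, MeasurableSet (B k)) :
    μ {ω | (∀ u, t u ω ∈ A u) ∧ ∀ k : SubgroupIndex lay, s k.1 k.2 ω ∈ B k} =
      (∫⁻ ω, ∏ u, Q (lay u) ω (A u) ∂μ) * ∫⁻ ω, ∏ k, P₀ ω (B k) ∂μ := by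
  let B' : Fin d → ℕ → Set X := fun j τ =>
    if h : τ ∈ Finset.Icc 1 (layerSize lay j) then B ⟨j, τ, h⟩ else Set.univ
  have hB' : ∀ j τ, MeasurableSet (B' j τ) := by
    intro j τ
    by_cases h : τ ∈ Finset.Icc 1 (layerSize lay j)
    · simpa only [B', h, dite_true] using hB _
    · simp only [B', h, dite_false, MeasurableSet.univ]
  have hB'k : ∀ k : SubgroupIndex lay, B' k.1 k.2 = B k := fun k => dif_pos k.2.2
  have h1 := hs.conditional_law A B' Set.univ hA hB' MeasurableSet.univ
  have hset : {ω | (∀ u, t u ω ∈ A u) ∧ (∀ j, ∀ τ ∈ Finset.Icc 1 (layerSize lay j),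
      s j τ ω ∈ B' j τ) ∧ ((fun j => Q j ω), P₀ ω) ∈ (Set.univ : Set _)} =
      {ω | (∀ u, t u ω ∈ A u) ∧ ∀ k : SubgroupIndex lay, s k.1 k.2 ω ∈ B k} := by
    ext ω
    simp only [Set.mem_univ, and_true, Set.mem_ofPred_eq]
    refine and_congr_right fun _ => ⟨fun h k => hB'k k ▸ h k.1 k.2 k.2.2, fun h j τ hτ => ?_⟩
    rw [hB'k ⟨j, τ, hτ⟩]
    exact h ⟨j, τ, hτ⟩
  have hprod : ∀ ω, ∏ j, ∏ τ ∈ Finset.Icc 1 (layerSize lay j), P₀ ω (B' j τ) =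
      ∏ k, P₀ ω (B k) := by
    intro ω
    rw [Fintype.prod_sigma]
    refine Finset.prod_congr rfl fun j _ => ?_
    rw [← Finset.prod_coe_sort]
    exact Finset.prod_congr rfl fun τ _ => by rw [← hB'k ⟨j, τ⟩]
  rw [hset] at h1
  simp only [Set.mem_univ, Set.ofPred_true, Measure.restrict_univ, hprod] at h1
  rw [h1]
  have hmF : Measurable fun q : Fin d → Measure T => ∏ u, q (lay u) (A u) :=
    Finset.measurable_fun_prod _ fun u _ =>
      (Measure.measurable_coe (hA u)).comp (measurable_pi_apply (lay u))
  have hmH : Measurable fun p : Measure X => ∏ k, p (B k) :=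
    Finset.measurable_fun_prod _ fun k _ => Measure.measurable_coe (hB k)
  exact lintegral_mul_eq_lintegral_mul_lintegral_of_indepFun
    (hmF.comp (measurable_pi_lambda _ fun j => (hs.dirichlet_layer j).measurable))
    (hmH.comp hs.dirichlet_root.measurable) (hs.indep_root.comp hmF hmH)

/-- The coordinate read off is itself random, but takes finitely many values; the preimage is split
accordingly. -/
lemma measurable_subgroup_profile [MeasurableEq T] (u : Fin N) :
    Measurable fun p : (Fin N → T) × (SubgroupIndex lay → X) => p.2 (subgroupIndex lay p.1 u) := by
  intro B hB
  have : (fun p : (Fin N → T) × (SubgroupIndex lay → X) => p.2 (subgroupIndex lay p.1 u)) ⁻¹' B =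
      ⋃ τ : Finset.Icc 1 (layerSize lay (lay u)),
        {t | subgroupLabel lay t u = τ} ×ˢ {x | x ⟨lay u, τ⟩ ∈ B} := by
    ext ⟨t, x⟩
    simp only [Set.mem_preimage, Set.mem_iUnion, Set.mem_prod, Set.mem_ofPred_eq]
    refine ⟨fun h => ⟨_, rfl, h⟩, ?_⟩
    rintro ⟨⟨τ, hτ⟩, h1, h2⟩
    obtain rfl : _ = τ := h1
    exact h2
  rw [this]
  exact MeasurableSet.iUnion fun τ => (measurableSet_eq_fun (measurable_orderLabel _ _)
    measurable_const).prod (measurable_pi_apply _ hB)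

lemma measurableSet_configuration [MeasurableEq T] [MeasurableEq X]
    (hs : IsHDPScheme μ lay θ θ₀ G G₀ Q P₀ t s) (v : Fin N) (z w : {u : Fin N // u ≠ v} → ℕ) :
    MeasurableSet {ω | zMinus lay (fun u => t u ω) (fun j τ => s j τ ω) v = z ∧
      wMinus lay (fun u => t u ω) v = w} := by
  have hprof : Measurable fun ω => nodeProfile lay (fun u => t u ω) (fun j τ => s j τ ω) :=
    measurable_pi_lambda _ fun u => (measurable_subgroup_profile u).comp
      (hs.measurable_nodes.prodMk hs.measurable_profiles)
  have hz : Measurable fun ω => zMinus lay (fun u => t u ω) (fun j τ => s j τ ω) v :=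
    measurable_pi_lambda _ fun u => (measurable_orderLabel {k | k ≠ v} (u : Fin N)).comp hprof
  exact (measurableSet_eq_fun hz measurable_const).inter
    (measurableSet_eq_fun (measurable_wMinus.comp hs.measurable_nodes) measurable_const)

variable [IsProbabilityMeasure μ]

lemma map_nodes_apply_univ_pi (hs : IsHDPScheme μ lay θ θ₀ G G₀ Q P₀ t s)
    {A : Fin N → Set T} (hA : ∀ u, MeasurableSet (A u)) :
    μ.map (fun ω u => t u ω) (Set.univ.pi A) = ∫⁻ ω, ∏ u, Q (lay u) ω (A u) ∂μ := by
  have hprob := hs.dirichlet_root.isProbabilityMeasure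
  have h := hs.measure_rectangle (B := fun _ => Set.univ) hA fun _ => MeasurableSet.univ
  simp only [measure_univ, Finset.prod_const_one, lintegral_const, mul_one, Set.mem_univ,
    implies_true, and_true] at h
  rw [Measure.map_apply hs.measurable_nodes (MeasurableSet.univ_pi hA), ← h]
  congr 1
  ext ω
  simp

lemma map_profiles_apply_univ_pi (hs : IsHDPScheme μ lay θ θ₀ G G₀ Q P₀ t s)
    {B : SubgroupIndex lay → Set X} (hB : ∀ k, MeasurableSet (B k)) :
    μ.map (fun ω (k : SubgroupIndex lay) => s k.1 k.2 ω) (Set.univ.pi B) =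
      ∫⁻ ω, ∏ k, P₀ ω (B k) ∂μ := by
  have hprob := fun j => (hs.dirichlet_layer j).isProbabilityMeasure
  have h := hs.measure_rectangle (A := fun _ => Set.univ) (fun _ => MeasurableSet.univ) hB
  simp only [measure_univ, Finset.prod_const_one, lintegral_const, one_mul, Set.mem_univ,
    implies_true, true_and] at h
  rw [Measure.map_apply hs.measurable_profiles (MeasurableSet.univ_pi hB), ← h]
  congr 1
  ext ω
  simp only [Set.mem_preimage, Set.mem_univ_pi, Set.mem_ofPred_eq]

/-- The labels of the nodes are independent of the profiles of the subgroups. -/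
lemma map_nodes_profiles (hs : IsHDPScheme μ lay θ θ₀ G G₀ Q P₀ t s) :
    μ.map (fun ω => ((fun u => t u ω), fun k : SubgroupIndex lay => s k.1 k.2 ω)) =
      (μ.map fun ω u => t u ω).prod (μ.map fun ω (k : SubgroupIndex lay) => s k.1 k.2 ω) := by
  have hm := hs.measurable_nodes.prodMk hs.measurable_profiles
  have := Measure.isProbabilityMeasure_map (μ := μ) hm.aemeasurable
  have := Measure.isProbabilityMeasure_map (μ := μ) hs.measurable_profiles.aemeasurable
  refine Measure.ext_of_univ_pi_prod fun A B hA hB => ?_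
  rw [Measure.prod_prod, hs.map_nodes_apply_univ_pi hA, hs.map_profiles_apply_univ_pi hB,
    ← hs.measure_rectangle hA hB,
    Measure.map_apply hm ((MeasurableSet.univ_pi hA).prod (MeasurableSet.univ_pi hB))]
  congr 1
  ext ω
  simp only [Set.mem_preimage, Set.mem_prod, Set.mem_univ_pi, Set.mem_ofPred_eq]

/-- The probability of an event about the groups and subgroups of the other nodes and of `v`. -/
lemma measure_groups_subgroups [MeasurableEq T] [MeasurableEq X]
    (hs : IsHDPScheme μ lay θ θ₀ G G₀ Q P₀ t s) {v : Fin N} {z : {u : Fin N // u ≠ v} → ℕ}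
    {H : Set ℕ} {W : Set (Fin N → T)} (hW : MeasurableSet W) :
    μ {ω | (zMinus lay (fun u => t u ω) (fun j τ => s j τ ω) v = z ∧
        zNode lay (fun u => t u ω) (fun j τ => s j τ ω) v ∈ H) ∧ (fun u => t u ω) ∈ W} =
      ∫⁻ t in W, (μ.map fun ω (k : SubgroupIndex lay) => s k.1 k.2 ω)
        (groupsEvent X v (subgroupIndex lay t) z ∩
          {x | orderLabel {k | k ≠ v} (fun k => x (subgroupIndex lay t k)) v ∈ H})
        ∂(μ.map fun ω u => t u ω) := by
  have hm := hs.measurable_nodes.prodMk hs.measurable_profiles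
  have := Measure.isProbabilityMeasure_map (μ := μ) hs.measurable_profiles.aemeasurable
  have hprof : Measurable fun (p : (Fin N → T) × (SubgroupIndex lay → X)) k =>
      p.2 (subgroupIndex lay p.1 k) := measurable_pi_lambda _ measurable_subgroup_profile
  let F : Set ((Fin N → T) × (SubgroupIndex lay → X)) :=
    {p | p.2 ∈ groupsEvent X v (subgroupIndex lay p.1) z ∩
      {x | orderLabel {k | k ≠ v} (fun k => x (subgroupIndex lay p.1 k)) v ∈ H}}
  have hF : MeasurableSet F := by
    have h1 : Measurable fun (p : (Fin N → T) × (SubgroupIndex lay → X))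
        (u : {u : Fin N // u ≠ v}) =>
          orderLabel {k | k ≠ v} (fun k => p.2 (subgroupIndex lay p.1 k)) u :=
      measurable_pi_lambda _ fun u => (measurable_orderLabel {k | k ≠ v} (u : Fin N)).comp hprof
    have h2 := (measurable_orderLabel (E := X) {k | k ≠ v} v).comp hprof
    exact (h1 (measurableSet_singleton z)).inter (h2 (MeasurableSet.of_discrete (s := H)))
  have hFW : MeasurableSet (F ∩ Prod.fst ⁻¹' W) := hF.inter (measurable_fst hW)
  refine (Measure.map_apply hm hFW).symm.trans ?_
  rw [hs.map_nodes_profiles, Measure.prod_apply hFW, ← lintegral_indicator hW]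
  refine lintegral_congr fun t' => ?_
  by_cases ht : t' ∈ W
  · rw [Set.indicator_of_mem ht]
    congr 1
    ext x
    exact and_iff_left ht
  · rw [Set.indicator_of_notMem ht, ← measure_empty
      (μ := μ.map fun ω (k : SubgroupIndex lay) => s k.1 k.2 ω)]
    congr 1
    ext x
    exact iff_of_false (fun h => ht h.2) id

end IsHDPScheme

/-! ### Subgroup counts by index, and the predictive formula -/

lemma totalSubgroups_eq_card_image {N d : ℕ} {T : Type*} {lay : Fin N → Fin d} {v : Fin N}
    (t : Fin N → T) : totalSubgroups (fun u : {u : Fin N // u ≠ v} => lay u) (wMinus lay t v) =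
      (Finset.univ.image fun u : {u : Fin N // u ≠ v} => subgroupIndex lay t u).card := by
  rw [card_image_congr (g := fun u : {u : Fin N // u ≠ v} => (lay u, wMinus lay t v u))
    fun a _ b _ => ?_, card_image_pair, totalSubgroups]
  · rfl
  · rw [subgroupIndex_eq_iff, Prod.mk.injEq]
    exact and_congr_right fun h => (wMinus_eq_iff h).symm

/-- Labels computed with and without `v` describe the same partition of the other nodes in each
layer, so either may be used for counting. -/
lemma profileSubgroups_eq_card_image {N d : ℕ} {T : Type*} {lay : Fin N → Fin d} {v : Fin N}
    (t : Fin N → T) (z : {u : Fin N // u ≠ v} → ℕ) (h : ℕ) :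
    profileSubgroups (fun u : {u : Fin N // u ≠ v} => lay u) z (wMinus lay t v) h =
      ((Finset.univ.filter fun u => z u = h).image
        fun u : {u : Fin N // u ≠ v} => subgroupIndex lay t u).card := by
  rw [card_image_congr (g := fun u : {u : Fin N // u ≠ v} => (lay u, wMinus lay t v u))
    fun a _ b _ => ?_, card_image_pair, profileSubgroups]
  · refine Finset.sum_congr rfl fun j _ => ?_
    rw [subgroupsWith, Finset.filter_filter]
    simp_rw [and_comm]
  · rw [subgroupIndex_eq_iff, Prod.mk.injEq]
    exact and_congr_right fun h => (wMinus_eq_iff h).symm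

theorem corollary3 {N d : ℕ} {Ω T X : Type*} [MeasurableSpace Ω]
    [MeasurableSpace T] [StandardBorelSpace T] [MeasurableSpace X] [StandardBorelSpace X]
    (μ : Measure Ω) [IsProbabilityMeasure μ]
    (lay : Fin N → Fin d) (θ θ₀ : ℝ) (hθ : 0 < θ) (hθ₀ : 0 < θ₀)
    (G : Fin d → Measure T) [∀ j, IsProbabilityMeasure (G j)] [∀ j, NullSingletonClass (G j)]
    (G₀ : Measure X) [IsProbabilityMeasure G₀] [NullSingletonClass G₀]
    (Q : Fin d → Ω → Measure T) (P₀ : Ω → Measure X)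
    (t : Fin N → Ω → T) (s : Fin d → ℕ → Ω → X)
    (hscheme : IsHDPScheme μ lay θ θ₀ G G₀ Q P₀ t s)
    -- a node `v`, and a configuration `(z, w)` of positive probability of `(z^{-v}, w^{-v})`
    (v : Fin N) (z w : {u : Fin N // u ≠ v} → ℕ)
    (hpos : μ {ω | zMinus lay (fun u => t u ω) (fun j τ => s j τ ω) v = z ∧
      wMinus lay (fun u => t u ω) v = w} ≠ 0)
    (h τ : ℕ) (hh : h ∈ Finset.Icc 1 (numGroups z + 1))
    (hτ : τ ∈ Finset.Icc 1 (numSubgroups (fun u : {u : Fin N // u ≠ v} => lay u) w (lay v) + 1)) :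
    (cond μ {ω | zMinus lay (fun u => t u ω) (fun j τ => s j τ ω) v = z ∧
        wMinus lay (fun u => t u ω) v = w}).real
      {ω | zNode lay (fun u => t u ω) (fun j τ => s j τ ω) v = h ∧
        wNode lay (fun u => t u ω) v = τ} =
    (∑ i, if τ = subgroupAt (fun u : {u : Fin N // u ≠ v} => lay u) z w (lay v) h i then
        (subgroupSize (fun u : {u : Fin N // u ≠ v} => lay u) z w (lay v) h i : ℝ) /
          (θ + (layerSize lay (lay v) : ℝ) - 1)
      else 0) +
    (if τ = numSubgroups (fun u : {u : Fin N // u ≠ v} => lay u) w (lay v) + 1 then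
        θ / (θ + (layerSize lay (lay v) : ℝ) - 1) *
          ((profileSubgroups (fun u : {u : Fin N // u ≠ v} => lay u) z w h : ℝ) /
              (θ₀ + (totalSubgroups (fun u : {u : Fin N // u ≠ v} => lay u) w : ℝ)) +
            if h = numGroups z + 1 then
              θ₀ / (θ₀ + (totalSubgroups (fun u : {u : Fin N // u ≠ v} => lay u) w : ℝ))
            else 0)
      else 0) := by
  classical
  have := measurableEq_of_standardBorel T
  have := measurableEq_of_standardBorel X
  have : Nonempty X := nonempty_of_isProbabilityMeasure G₀
  let layM : {u : Fin N // u ≠ v} → Fin d := fun u => lay u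
  let νT := μ.map fun ω u => t u ω
  let νX := μ.map fun ω (k : SubgroupIndex lay) => s k.1 k.2 ω
  have hνTprob : IsProbabilityMeasure νT :=
    Measure.isProbabilityMeasure_map hscheme.measurable_nodes.aemeasurable
  have hνXprob : IsProbabilityMeasure νX :=
    Measure.isProbabilityMeasure_map hscheme.measurable_profiles.aemeasurable
  let W : Set (Fin N → T) := {t | wMinus lay t v = w}
  let Wτ : Set (Fin N → T) := {t | wMinus lay t v = w ∧ wNode lay t v = τ}
  have hW : MeasurableSet W := measurableSet_eq_fun measurable_wMinus measurable_const
  have hWτ : MeasurableSet Wτ :=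
    hW.inter (measurableSet_eq_fun measurable_wNode measurable_const)
  let A : Set Ω := {ω | zMinus lay (fun u => t u ω) (fun j τ => s j τ ω) v = z ∧
    wMinus lay (fun u => t u ω) v = w}
  let B : Set Ω := {ω | zNode lay (fun u => t u ω) (fun j τ => s j τ ω) v = h ∧
    wNode lay (fun u => t u ω) v = τ}
  have hA : μ A = ∫⁻ t in W, νX (groupsEvent X v (subgroupIndex lay t) z) ∂νT := by
    have h1 := hscheme.measure_groups_subgroups (v := v) (z := z) (H := Set.univ) hW
    simp only [Set.mem_univ, and_true, Set.ofPred_true, Set.inter_univ] at h1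
    exact h1
  have hAB : μ (A ∩ B) = ∫⁻ t in Wτ, νX (groupsEvent X v (subgroupIndex lay t) z ∩
      {x | orderLabel {k | k ≠ v} (fun k => x (subgroupIndex lay t k)) v = h}) ∂νT := by
    have h1 := hscheme.measure_groups_subgroups (v := v) (z := z) (H := {h}) hWτ
    simp only [Set.mem_singleton_iff] at h1
    rw [← h1]
    congr 1
    ext ω
    exact and_and_and_comm
  -- a configuration of the labels in the conditioning event
  obtain ⟨t₀, ht₀W, hg0⟩ : ∃ t₀ ∈ W, νX (groupsEvent X v (subgroupIndex lay t₀) z) ≠ 0 := by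
    by_contra! hcon
    exact hpos (hA.trans ((setLIntegral_congr_fun hW hcon).trans lintegral_zero))
  set g := νX (groupsEvent X v (subgroupIndex lay t₀) z) with hg
  have hties : ∀ t ∈ W, ∀ u u' : {u : Fin N // u ≠ v},
      subgroupIndex lay t u = subgroupIndex lay t u' ↔ layM u = layM u' ∧ w u = w u' := by
    intro t ht u u'
    rw [subgroupIndex_eq_iff, ← show wMinus lay t v = w from ht]
    exact and_congr_right fun hl => (wMinus_eq_iff hl).symm
  -- On `W` the ties among subgroup indices of the other nodes are prescribed by `w`, so
  -- exchangeability makes this probability constant.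
  have hgt : ∀ t ∈ W, νX (groupsEvent X v (subgroupIndex lay t) z) = g := fun t ht =>
    measure_groupsEvent_congr hscheme.dirichlet_root
      (fun B hB => hscheme.map_profiles_apply_univ_pi hB) fun u u' hu hu' =>
        (hties t ht ⟨u, hu⟩ ⟨u', hu'⟩).trans (hties t₀ ht₀W ⟨u, hu⟩ ⟨u', hu'⟩).symm
  -- Positive probability provides a profile array realizing `z`, which forces `z` to be constant on
  -- subgroups.
  have hz : ∀ u u', layM u = layM u' → w u = w u' → z u = z u' := by
    intro u u' hl hw
    obtain ⟨x, hx⟩ := nonempty_of_measure_ne_zero hg0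
    have hκ := (hties t₀ ht₀W u u').2 ⟨hl, hw⟩
    rw [← show _ = z from hx]
    exact orderLabel_eq_of_eq (congrArg x hκ)
  have hzκ : ∀ t ∈ W, ∀ u u' : {u : Fin N // u ≠ v},
      subgroupIndex lay t u = subgroupIndex lay t u' → z u = z u' := fun t ht u u' hκ =>
    hz u u' ((hties t ht u u').1 hκ).1 ((hties t ht u u').1 hκ).2
  have hAg : μ A = νT W * g := by
    rw [hA, setLIntegral_congr_fun hW hgt, lintegral_const, Measure.restrict_apply_univ, mul_comm]
  have hABr : ∀ r, (∀ t ∈ Wτ, νX (groupsEvent X v (subgroupIndex lay t) z ∩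
      {x | orderLabel {k | k ≠ v} (fun k => x (subgroupIndex lay t k)) v = h}) = r) →
      μ (A ∩ B) = νT Wτ * r := by
    intro r hr
    rw [hAB, setLIntegral_congr_fun hWτ hr, lintegral_const, Measure.restrict_apply_univ, mul_comm]
  have hcond : (cond μ A).real B = (μ A).toReal⁻¹ * (μ (A ∩ B)).toReal := by
    rw [measureReal_def, cond_apply (hscheme.measurableSet_configuration v z w),
      ENNReal.toReal_mul, ENNReal.toReal_inv]
  have hsub := measure_wMinus_wNode hθ hscheme.dirichlet_layer hscheme.indep_layers νT
    (fun A hA => hscheme.map_nodes_apply_univ_pi hA) v w τ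
  change ENNReal.ofReal _ * νT Wτ = (_ * (if τ = numSubgroups layM w (lay v) + 1 then 1 else 0) + _)
    * νT W at hsub
  have hV : (0 : ℝ) < θ + layerSize lay (lay v) - 1 := by
    rw [layerSize_eq_card_add_one]
    push_cast
    linarith [Nat.cast_nonneg (α := ℝ)
      (Finset.univ.filter fun u => u ≠ v ∧ lay u = lay v).card]
  set c := θ + layerSize lay (lay v) - 1 with hc
  have hgreal : g.toReal ≠ 0 := ENNReal.toReal_ne_zero.2 ⟨hg0, measure_ne_top _ _⟩
  have hWreal : (νT W).toReal ≠ 0 := by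
    refine ENNReal.toReal_ne_zero.2 ⟨fun h0 => hpos ?_, measure_ne_top _ _⟩
    exact hAg.trans (by rw [h0, zero_mul])
  rw [sum_subgroupSize]
  refine hcond.trans ?_
  change (μ A).toReal⁻¹ * (μ (A ∩ B)).toReal = _ + if τ = numSubgroups layM w (lay v) + 1
    then θ / c * ((profileSubgroups layM z w h : ℝ) / (θ₀ + (totalSubgroups layM w : ℝ)) +
      if h = numGroups z + 1 then θ₀ / (θ₀ + (totalSubgroups layM w : ℝ)) else 0) else 0
  rw [hAg, ENNReal.toReal_mul]
  by_cases hnew : τ = numSubgroups layM w (lay v) + 1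
  -- New subgroup: its profile index is used by no other node, so the root urn determines the group
  -- of `v`.
  · have hnone : ∀ u, layM u = lay v → w u ≠ τ := by
      intro u hl hw
      have h1 := wMinus_le_numSubgroups (t := t₀) (u := u) hl
      rw [show wMinus lay t₀ v = w from ht₀W, hw, hnew] at h1
      exact absurd h1 (by simp [layM])
    have hκv : ∀ t ∈ Wτ, ∀ u, u ≠ v → subgroupIndex lay t u ≠ subgroupIndex lay t v := by
      intro t ht u hu hκ
      obtain ⟨hl, htu⟩ := subgroupIndex_eq_iff.1 hκ
      refine hnone ⟨u, hu⟩ hl ?_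
      rw [← show wMinus lay t v = w from ht.1, ← ht.2]
      exact (wMinus_eq_wNode_iff (u := ⟨u, hu⟩) hl).2 htu
    have hroot : ∀ t ∈ Wτ, ENNReal.ofReal (θ₀ + totalSubgroups layM w) *
        νX (groupsEvent X v (subgroupIndex lay t) z ∩
          {x | orderLabel {k | k ≠ v} (fun k => x (subgroupIndex lay t k)) v = h}) =
        (ENNReal.ofReal θ₀ * (if h = numGroups z + 1 then 1 else 0) +
          profileSubgroups layM z w h) * g := by
      intro t ht
      have h1 := measure_groupsEvent_new hscheme.dirichlet_root hθ₀
        (fun B hB => hscheme.map_profiles_apply_univ_pi hB) (hκv t ht) (hzκ t ht.1) h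
      rw [← totalSubgroups_eq_card_image, ← profileSubgroups_eq_card_image,
        show wMinus lay t v = w from ht.1] at h1
      rw [← hgt t ht.1]
      exact h1
    have hL : (0 : ℝ) < θ₀ + totalSubgroups layM w := by positivity
    have hL' : ENNReal.ofReal (θ₀ + totalSubgroups layM w) ≠ 0 := by simpa using hL
    have hr := hABr ((ENNReal.ofReal (θ₀ + totalSubgroups layM w))⁻¹ *
        ((ENNReal.ofReal θ₀ * (if h = numGroups z + 1 then 1 else 0) +
          profileSubgroups layM z w h) * g)) fun t ht => by
      rw [← hroot t ht, ← mul_assoc, ENNReal.inv_mul_cancel hL' ENNReal.ofReal_ne_top, one_mul]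
    have hcount : (Finset.univ.filter fun u => layM u = lay v ∧ w u = τ).card = 0 := by
      rw [Finset.card_eq_zero, Finset.filter_eq_empty_iff]
      exact fun u _ hu => hnone u hu.1 hu.2
    have hcount' : (Finset.univ.filter fun u => layM u = lay v ∧ z u = h ∧ w u = τ).card = 0 := by
      rw [Finset.card_eq_zero, Finset.filter_eq_empty_iff]
      exact fun u _ hu => hnone u hu.1 hu.2.2
    have hsub' := congrArg ENNReal.toReal hsub
    rw [hcount, if_pos hnew, ENNReal.toReal_mul, ENNReal.toReal_ofReal hV.le, Nat.cast_zero,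
      add_zero, mul_one, ENNReal.toReal_mul, ENNReal.toReal_ofReal hθ.le] at hsub'
    rw [hcount', if_pos hnew, hr, ENNReal.toReal_mul, ENNReal.toReal_mul, ENNReal.toReal_mul,
      ENNReal.toReal_inv, ENNReal.toReal_ofReal hL.le]
    have hWτreal : (νT Wτ).toReal = θ * (νT W).toReal / c := by
      rw [eq_div_iff hV.ne', mul_comm, hsub']
    have hnum : (ENNReal.ofReal θ₀ * (if h = numGroups z + 1 then 1 else 0) +
        (profileSubgroups layM z w h : ℝ≥0∞)).toReal =
        (if h = numGroups z + 1 then θ₀ else 0) + profileSubgroups layM z w h := by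
      rw [ENNReal.toReal_add (by split_ifs <;> simp) (by simp)]
      split_ifs <;> simp [hθ₀.le]
    rw [hnum, hWτreal]
    split_ifs <;> field_simp <;> simp [add_comm]
  · rw [if_neg hnew, add_zero]
    have hsub' := congrArg ENNReal.toReal hsub
    rw [if_neg hnew, ENNReal.toReal_mul, ENNReal.toReal_ofReal hV.le, mul_zero, zero_add,
      ENNReal.toReal_mul, ENNReal.toReal_natCast] at hsub'
    have hWτreal : (νT Wτ).toReal = (Finset.univ.filter fun u => layM u = lay v ∧ w u = τ).card *
        (νT W).toReal / c := by
      rw [eq_div_iff hV.ne', mul_comm, hsub']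
    by_cases hex : ∃ u, layM u = lay v ∧ w u = τ
    · obtain ⟨u₀, hl₀, hw₀⟩ := hex
      -- Old subgroup: `v` shares the profile of `u₀`, so its group is `z u₀` with certainty.
      have hold : ∀ t ∈ Wτ, νX (groupsEvent X v (subgroupIndex lay t) z ∩
          {x | orderLabel {k | k ≠ v} (fun k => x (subgroupIndex lay t k)) v = h}) =
          if z u₀ = h then g else 0 := by
        intro t ht
        have htu : t u₀ = t v := by
          rw [← wMinus_eq_wNode_iff hl₀, show wMinus lay t v = w from ht.1, hw₀]
          exact ht.2.symm
        have hκ : subgroupIndex lay t u₀ = subgroupIndex lay t v :=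
          subgroupIndex_eq_iff.2 ⟨hl₀, htu⟩
        have hset : groupsEvent X v (subgroupIndex lay t) z ∩
            {x | orderLabel {k | k ≠ v} (fun k => x (subgroupIndex lay t k)) v = h} =
            groupsEvent X v (subgroupIndex lay t) z ∩ {_x | z u₀ = h} := by
          ext x
          refine and_congr_right fun hx => ?_
          have h1 : orderLabel {k | k ≠ v} (fun k => x (subgroupIndex lay t k)) v = z u₀ := by
            rw [← show _ = z from hx]
            exact orderLabel_eq_of_eq (congrArg x hκ.symm)
          exact Eq.congr_left h1
        rw [hset]
        split_ifs with hzh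
        · simpa [hzh] using hgt t ht.1
        · simp [hzh]
      rw [hABr _ hold, ENNReal.toReal_mul, hWτreal]
      have hfilter : (Finset.univ.filter fun u => layM u = lay v ∧ z u = h ∧ w u = τ) =
          if z u₀ = h then Finset.univ.filter fun u => layM u = lay v ∧ w u = τ else ∅ := by
        ext u
        have hzu : layM u = lay v → w u = τ → z u = z u₀ := fun hl hw =>
          hz u u₀ (hl.trans hl₀.symm) (hw.trans hw₀.symm)
        split_ifs with hzh
        · simp only [Finset.mem_filter, Finset.mem_univ, true_and]
          exact ⟨fun hu => ⟨hu.1, hu.2.2⟩, fun hu => ⟨hu.1, (hzu hu.1 hu.2).trans hzh, hu.2⟩⟩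
        · simp only [Finset.mem_filter, Finset.mem_univ, true_and, Finset.notMem_empty, iff_false]
          exact fun hu => hzh ((hzu hu.1 hu.2.2).symm.trans hu.2.1)
      change _ = ((Finset.univ.filter fun u => layM u = lay v ∧ z u = h ∧ w u = τ).card : ℝ) / c
      rw [hfilter]
      split_ifs
      · field_simp
      · simp
    -- When no other node of the layer has label `τ`, both sides are zero; treating this directly
    -- avoids proving that labels in order of appearance have no gaps.
    · push Not at hex
      have hcount : (Finset.univ.filter fun u => layM u = lay v ∧ w u = τ).card = 0 := by
        rw [Finset.card_eq_zero, Finset.filter_eq_empty_iff]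
        exact fun u _ hu => hex u hu.1 hu.2
      have hcount' :
          (Finset.univ.filter fun u => layM u = lay v ∧ z u = h ∧ w u = τ).card = 0 := by
        rw [Finset.card_eq_zero, Finset.filter_eq_empty_iff]
        exact fun u _ hu => hex u hu.1 hu.2.2
      have hWτ0 : νT Wτ = 0 := by
        rw [hcount, Nat.cast_zero, zero_mul, zero_div] at hWτreal
        exact (ENNReal.toReal_eq_zero_iff _).1 hWτreal |>.resolve_right (measure_ne_top _ _)
      rw [hAB, setLIntegral_measure_zero _ _ hWτ0, ENNReal.toReal_zero, mul_zero]
      change _ = ((Finset.univ.filter fun u => layM u = lay v ∧ z u = h ∧ w u = τ).card : ℝ) / c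
      rw [hcount', Nat.cast_zero, zero_div]
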